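/- Fix $n\ge 0$ and let $[n]=\{1,\dots,n\}$. For $w\in S_n$ let $\ell(w)$ be its number of inversions and write $w[k]=\{w(1),\dots,w(k)\}$. The quantum Bruhat graph on $S_n$ has an edge $w\to wt_{ij}$, where $i<j$ and $t_{ij}=(i\;j)$, whenever $\ell(wt_{ij})=\ell(w)+1$ or $\ell(wt_{ij})=\ell(w)+1-2(j-i)$. Let $\ell(u,v)$ be the length of a shortest directed path from $u$ to $v$ in it. For $u\in S_n$ the tilted Bruhat order $\le_u$ is given by $w\le_u v \iff \ell(u,w)+\ell(w,v)=\ell(u,v)$, and for $w\le_u v$ put $[w,v]_u=\{x: w\le_u x\le_u v\}$. Write $[u,v]=[u,v]_u$. A tilted subinterval $[x,y]\subseteq[u,v]$ is an interval $[x,y]_u$ of the order $\le_u$ (so $x\le_u y$) that is contained in $[u,v]$. For $r\in[n]$ let $\le_r$ be the linear order $r<_r r+1<_r\cdots<_r n<_r 1<_r\cdots<_r r-1$ on $[n]$, and for $A=\{a_1<_r\cdots<_r a_k\}$ and $B=\{b_1<_r\cdots<_r b_k\}$ write $A\le_r B$ if $a_i\le_r b_i$ for all $i$. For a sequence $\mathbf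 a=(a_1,\dots,a_{n-1})$ in $[n]$ write $u\le_{\mathbf a}v$ if $u[k]\le_{a_k}v[k]$ for all $1\le k\le n-1$. For $S\subseteq[n]$ let $\mathrm{Proj}_S:\mathbb C^n\to\mathbb C^S$ be the coordinate projection. For $r,j\in[n]$ let $[r,j]_c=\{i\in[n]: i\le_r j\}$ and $[j,r-1]_c=\{i\in[n]: j\le_r i\}$ be the cyclic intervals. Let $\mathcal T_{u,v,\mathbf a}$ be the set of complete flags $F_\bullet=(0=F_0\subset F_1\subset\cdots\subset F_n=\mathbb C^n)$ such that $$\dim \mathrm{Proj}_{[a_k,j]_c}(F_k)\le \#\bigl(u[k]\cap[a_k,j]_c\bigr),\qquad \dim \mathrm{Proj}_{[j,a_k-1]_c}(F_k)\le \#\bigl(v[k]\cap[j,a_k-1]_c\bigr)$$ for all $1\le k\le n-1$ and $j\in[n]$, and let $\mathcal T^\circ_{u,v,\mathbf a}$ be the set of complete flags for which all these inequalities are equalities. **Theorem.** Let $u,v\in S_n$. There is a sequence $\mathbf a$ with $u\le_{\mathbf a}v$, and $\mathcal T_{u,v}:=\mathcal T_{u,v,\mathbf a}$ and $\mathcal T^\circ_{u,v}:=\mathcal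 T^\circ_{u,v,\mathbf a}$ do not depend on the choice of such an $\mathbf a$. The tilted Richardson variety $\mathcal T_{u,v}$ decomposes as the disjoint union $$\mathcal T_{u,v}=\bigsqcup_{[x,y]\subseteq[u,v]}\mathcal T^\circ_{x,y}$$ over all tilted subintervals $[x,y]\subseteq[u,v]$, that is, over all pairs $(x,y)$ with $x\le_u y$ and $[x,y]_u\subseteq[u,v]$; the strata of distinct pairs are disjoint. -/

import Mathlib

namespace TiltedRichardson

/-! ### The quantum Bruhat graph and the tilted Bruhat orders

Permutations of `[n]` are elements of `Equiv.Perm (Fin n)`; the number `i ∈ {1, …, n}` is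
the element of value `i - 1` of `Fin n`. -/

/-- The length `ℓ(w)`: the number of inversions, i.e. of pairs `i < j` with `w i > w j`. -/
def length {n : ℕ} (w : Equiv.Perm (Fin n)) : ℕ :=
  (Finset.univ.filter fun p : Fin n × Fin n => p.1 < p.2 ∧ w p.2 < w p.1).card

/-- The edges `w → w tᵢⱼ` (`i < j`) of the quantum Bruhat graph: either
`ℓ(w tᵢⱼ) = ℓ(w) + 1`, or `ℓ(w tᵢⱼ) = ℓ(w) + 1 - 2 (j - i)` (written without subtraction of
lengths; the product of permutations is composition, so `(w * swap i j) i = w j`). -/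
def QBGEdge {n : ℕ} (w w' : Equiv.Perm (Fin n)) : Prop :=
  ∃ i j : Fin n, i < j ∧ w' = w * Equiv.swap i j ∧
    (length w' = length w + 1 ∨ length w' + 2 * (j.val - i.val) = length w + 1)

/-- There is a directed path with `k` edges from `u` to `v` in the quantum Bruhat graph. -/
def HasPath {n : ℕ} (u v : Equiv.Perm (Fin n)) (k : ℕ) : Prop :=
  ∃ p : ℕ → Equiv.Perm (Fin n), p 0 = u ∧ p k = v ∧ ∀ i < k, QBGEdge (p i) (p (i + 1))

/-- `ℓ(u, v)`: the length of a shortest directed path from `u` to `v` in the quantum Bruhat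
graph (the graph is strongly connected, so the infimum is over a nonempty set). -/
noncomputable def dist {n : ℕ} (u v : Equiv.Perm (Fin n)) : ℕ :=
  sInf {k : ℕ | HasPath u v k}

/-- The tilted Bruhat order `w ≤_u v`, that is `ℓ(u, w) + ℓ(w, v) = ℓ(u, v)`. -/
def TiltedLE {n : ℕ} (u w v : Equiv.Perm (Fin n)) : Prop :=
  dist u w + dist w v = dist u v

/-- The tilted Bruhat interval `[w, v]_u = {x | w ≤_u x ≤_u v}`; it is used for `w ≤_u v`. -/
def tiltedInterval {n : ℕ} (u w v : Equiv.Perm (Fin n)) : Set (Equiv.Perm (Fin n)) :=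
  {x | TiltedLE u w x ∧ TiltedLE u x v}

/-- The tilted subintervals `[x, y] ⊆ [u, v]`, given by their endpoints: intervals `[x, y]_u`
of the tilted Bruhat order `≤_u` (thus `x ≤_u y`) that are contained in `[u, v] = [u, v]_u`. -/
def subintervals {n : ℕ} (u v : Equiv.Perm (Fin n)) :
    Set (Equiv.Perm (Fin n) × Equiv.Perm (Fin n)) :=
  {p | TiltedLE u p.1 p.2 ∧ tiltedInterval u p.1 p.2 ⊆ tiltedInterval u u v}

/-! ### Shifted orders -/

/-- The shifted linear order `r <_r r+1 <_r ⋯ <_r n <_r 1 <_r ⋯ <_r r-1` on `[n]`: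
`i ≤_r j`. Subtraction in `Fin n` is cyclic, so `i - r` is the position of `i` after `r`. -/
def ShiftLE {n : ℕ} (r i j : Fin n) : Prop := i - r ≤ j - r

instance {n : ℕ} (r i j : Fin n) : Decidable (ShiftLE r i j) :=
  inferInstanceAs (Decidable (i - r ≤ j - r))

/-- The cyclic interval `[r, j]_c = {r, r+1, …, j}` (cyclically), i.e. all `i ≤_r j`. -/
def segFrom {n : ℕ} (r j : Fin n) : Finset (Fin n) :=
  Finset.univ.filter fun i => ShiftLE r i j

/-- The cyclic interval `[j, r-1]_c = {j, j+1, …, r-1}` (cyclically), i.e. all `i ≥_r j`;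
it is `{j, …, n}` if `r` is the first element of `[n]`. -/
def segTo {n : ℕ} (r j : Fin n) : Finset (Fin n) :=
  Finset.univ.filter fun i => ShiftLE r j i

/-- The shifted Gale order `A ≤_r B`: the two sets have equal size, and when
`A = {a₁ <_r ⋯ <_r a_k}` and `B = {b₁ <_r ⋯ <_r b_k}`, then `aᵢ ≤_r bᵢ` for all `i`.
(The elements are listed in increasing order through their positions after `r`.) -/
def GaleLE {n : ℕ} (r : Fin n) (A B : Finset (Fin n)) : Prop :=
  List.Forall₂ (· ≤ ·) ((A.image fun i => i - r).sort (· ≤ ·))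
    ((B.image fun i => i - r).sort (· ≤ ·))

/-- `w[k] = {w(1), …, w(k)}`. -/
def firstValues {n : ℕ} (w : Equiv.Perm (Fin n)) (k : ℕ) : Finset (Fin n) :=
  (Finset.univ.filter fun i : Fin n => i.val < k).image w

/-- `u ≤_𝐚 v` for a sequence `𝐚 = (a₁, …, a_{n-1})` in `[n]`: `u[k] ≤_{a_k} v[k]` for all
`k ∈ {1, …, n-1}`. The index `k : Fin (n - 1)` stands for `k + 1 ∈ {1, …, n-1}`. -/
def SeqLE {n : ℕ} (a : Fin (n - 1) → Fin n) (u v : Equiv.Perm (Fin n)) : Prop :=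
  ∀ k : Fin (n - 1), GaleLE (a k) (firstValues u (k + 1)) (firstValues v (k + 1))

/-! ### Complete flags and tilted Richardson varieties -/

/-- A point of the complete flag variety `Fl_n`: subspaces `F_0 ⊂ F_1 ⊂ ⋯ ⊂ F_n` of `ℂⁿ`
with `dim F_k = k`. -/
@[ext]
structure CompleteFlag (n : ℕ) where
  /-- The subspaces of the flag. -/
  space : Fin (n + 1) → Submodule ℂ (Fin n → ℂ)
  mono : Monotone space
  finrank_space : ∀ k, Module.finrank ℂ (space k) = k.val

/-- The proper part `F_{k+1}`, where `k + 1 ∈ {1, …, n-1}`. -/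
def CompleteFlag.step {n : ℕ} (F : CompleteFlag n) (k : Fin (n - 1)) :
    Submodule ℂ (Fin n → ℂ) :=
  F.space ⟨k.val + 1, by omega⟩

/-- `dim (Proj_S V)`, where `Proj_S : ℂⁿ → ℂ^S` is the projection onto the coordinates with
indices in `S`. -/
noncomputable def projDim {n : ℕ} (S : Finset (Fin n)) (V : Submodule ℂ (Fin n → ℂ)) : ℕ :=
  Module.finrank ℂ (V.map (LinearMap.funLeft ℂ ℂ (Subtype.val : {i // i ∈ S} → Fin n)))

/-- The open tilted Richardson variety `T°_{u,v,𝐚}` with respect to `𝐚`. (The condition for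
the whole space `F_n = ℂⁿ` would hold automatically.) -/
def openTiltedRichardsonWrt {n : ℕ} (a : Fin (n - 1) → Fin n) (u v : Equiv.Perm (Fin n)) :
    Set (CompleteFlag n) :=
  {F | ∀ (k : Fin (n - 1)) (j : Fin n),
    projDim (segFrom (a k) j) (F.step k) = (firstValues u (k + 1) ∩ segFrom (a k) j).card ∧
    projDim (segTo (a k) j) (F.step k) = (firstValues v (k + 1) ∩ segTo (a k) j).card}

/-- The tilted Richardson variety `T_{u,v,𝐚}` with respect to `𝐚`. -/
def tiltedRichardsonWrt {n : ℕ} (a : Fin (n - 1) → Fin n) (u v : Equiv.Perm (Fin n)) :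
    Set (CompleteFlag n) :=
  {F | ∀ (k : Fin (n - 1)) (j : Fin n),
    projDim (segFrom (a k) j) (F.step k) ≤ (firstValues u (k + 1) ∩ segFrom (a k) j).card ∧
    projDim (segTo (a k) j) (F.step k) ≤ (firstValues v (k + 1) ∩ segTo (a k) j).card}

/-- The open tilted Richardson variety `T°_{u,v}`: the set `T°_{u,v,𝐚}` for a sequence `𝐚` with
`u ≤_𝐚 v`, where the choice of `𝐚` does not matter. -/
def openTiltedRichardson {n : ℕ} (u v : Equiv.Perm (Fin n)) : Set (CompleteFlag n) :=
  {F | ∃ a : Fin (n - 1) → Fin n, SeqLE a u v ∧ F ∈ openTiltedRichardsonWrt a u v}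

/-- The tilted Richardson variety `T_{u,v}`: the set `T_{u,v,𝐚}` for a sequence `𝐚` with
`u ≤_𝐚 v`, where the choice of `𝐚` does not matter. -/
def tiltedRichardson {n : ℕ} (u v : Equiv.Perm (Fin n)) : Set (CompleteFlag n) :=
  {F | ∃ a : Fin (n - 1) → Fin n, SeqLE a u v ∧ F ∈ tiltedRichardsonWrt a u v}

end TiltedRichardson

namespace TiltedRichardson

/-! ### The shifted Gale order through counting functions -/

/-! For sets `A`, `B` of equal size let h_{A,B}(t) be the number of elements of `B` below t minus
the number of elements of `A` below t. Then A ≤_r B holds exactly when r maximizes h_{A,B}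
(`galeLE_iff_height`), so some r always exists. Since h_{A,B} + h_{B,C} = h_{A,C}, any r that works
for the ends of a chain can replace the one for which the chain was given (`GaleLE.change`).

A subspace V of ℂⁿ represents a matroid, which has a least and a greatest basis for ≤_r. The rank
conditions on V say that u[k] lies below the least basis and v[k] above the greatest one, with
equality for the open variety. By `GaleLE.change` these two bases are the same for every r with u[k]
≤_r v[k], so the choice of `a` is immaterial. Consecutive levels k and k+1 have a common r
(`exists_galeLE_insert`), and for a fixed order greedy bases grow with the subspace. Hence the least
bases of the spaces of a flag in T_{u,v} form a chain x[1] ⊂ x[2] ⊂ ⋯ for a permutation x, the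
greatest bases one for a permutation y, and the flag lies in T°_{x,y} with u ≤_a x ≤_a y ≤_a v. The
flag determines x and y, so the strata are disjoint.

It remains to identify these pairs with the tilted subintervals. The distance in the quantum Bruhat
graph is ℓ(v) - ℓ(u) + 2 ∑ₖ max h_{u[k],v[k]} (`dist_eq_pathLength`): the right side satisfies the
triangle inequality and is 1 on edges, and whenever u ≤_a v and u ≠ v, some edge u → u' has u ≤_a u'
≤_a v (`exists_qbgEdge`). Distances along u, w, v therefore add up exactly when each maximum does,
that is, when u ≤_a w ≤_a v (`tiltedLE_self_iff`). -/

lemma val_sub_eq {n : ℕ} (i r : Fin n) :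
    (i - r).val = if r.val ≤ i.val then i.val - r.val else n + i.val - r.val := by
  have hi := i.isLt
  have hr := r.isLt
  rw [Fin.sub_def]
  show (n - r.val + i.val) % n = _
  split_ifs with h
  · rw [show n - r.val + i.val = (i.val - r.val) + n by omega, Nat.add_mod_right,
      Nat.mod_eq_of_lt (by omega)]
  · rw [Nat.mod_eq_of_lt (by omega)]; omega

lemma val_sub_injective {n : ℕ} (r : Fin n) : Function.Injective fun i : Fin n => (i - r).val := by
  intro i j h
  simp only [val_sub_eq] at h
  apply Fin.ext
  have := i.isLt
  have := j.isLt
  split_ifs at h <;> omega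

lemma sub_right_injective_fin {n : ℕ} (r : Fin n) : Function.Injective fun i : Fin n => i - r :=
  fun _ _ h => val_sub_injective r (congrArg Fin.val h)

lemma forall₂_le_iff_countP {α : Type*} [LinearOrder α] : ∀ {l₁ l₂ : List α},
    l₁.Pairwise (· ≤ ·) → l₂.Pairwise (· ≤ ·) →
    (List.Forall₂ (· ≤ ·) l₁ l₂ ↔
      l₁.length = l₂.length ∧ ∀ x, l₂.countP (· ≤ x) ≤ l₁.countP (· ≤ x))
  | [], [], _, _ => by simp
  | [], b :: l₂, _, _ => by simp
  | a :: l₁, [], _, _ => by simp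
  | a :: l₁, b :: l₂, h₁, h₂ => by
    rw [List.pairwise_cons] at h₁ h₂
    rw [List.forall₂_cons, forall₂_le_iff_countP h₁.2 h₂.2]
    simp only [List.length_cons, Nat.add_right_cancel_iff, List.countP_cons]
    constructor
    · rintro ⟨hab, hl, hc⟩
      refine ⟨hl, fun x => ?_⟩
      have := hc x
      by_cases hb : b ≤ x
      · simp [hb, hab.trans hb, this]
      · simp only [hb, decide_false, Bool.false_eq_true, if_false]
        omega
    · rintro ⟨hl, hc⟩
      have hab : a ≤ b := by
        -- If b < a, then b is a threshold that the second list meets and no entry of the first list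
        -- does.
        by_contra hab
        have h := hc b
        have h0 : l₁.countP (· ≤ b) = 0 := by
          rw [List.countP_eq_zero]
          intro c hc'
          have := h₁.1 c hc'
          simp only [decide_eq_true_eq, not_le]
          exact lt_of_lt_of_le (not_le.1 hab) this
        simp [h0, hab] at h
      refine ⟨hab, hl, fun x => ?_⟩
      have h := hc x
      by_cases hb : b ≤ x
      · simpa [hb, hab.trans hb] using h
      · have h0 : l₂.countP (· ≤ x) = 0 := by
          rw [List.countP_eq_zero]
          intro c hc'
          have := h₂.1 c hc'
          simp only [decide_eq_true_eq, not_le]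
          exact lt_of_lt_of_le (not_le.1 hb) this
        omega

/-- The number of elements of `A` among the first `t` elements of the order `≤_r`. -/
def shiftCount {n : ℕ} (r : Fin n) (A : Finset (Fin n)) (t : ℕ) : ℕ :=
  (A.filter fun i => (i - r).val < t).card

/-- The number of elements of `A` of value less than `t`. -/
def prefixCount {n : ℕ} (A : Finset (Fin n)) (t : ℕ) : ℕ :=
  (A.filter fun i => i.val < t).card

lemma countP_sort_image {n : ℕ} (r : Fin n) (A : Finset (Fin n)) (x : Fin n) :
    ((A.image fun i => i - r).sort (· ≤ ·)).countP (· ≤ x) = shiftCount r A (x.val + 1) := by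
  rw [← Multiset.coe_countP, Finset.sort_eq, Multiset.countP_eq_card_filter]
  change ((A.image fun i => i - r).filter (· ≤ x)).card = _
  rw [Finset.filter_image, Finset.card_image_of_injective _ (sub_right_injective_fin r)]
  unfold shiftCount
  congr 1
  ext i
  simp only [Finset.mem_filter, Fin.le_def, Nat.lt_succ_iff]

lemma shiftCount_of_le {n : ℕ} (r : Fin n) (A : Finset (Fin n)) {t : ℕ} (ht : n ≤ t) :
    shiftCount r A t = A.card := by
  unfold shiftCount
  rw [Finset.filter_true_of_mem]
  intro i _
  exact (i - r).isLt.trans_le ht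

lemma galeLE_iff_shiftCount {n : ℕ} {r : Fin n} {A B : Finset (Fin n)} :
    GaleLE r A B ↔ A.card = B.card ∧ ∀ t, shiftCount r B t ≤ shiftCount r A t := by
  unfold GaleLE
  rw [forall₂_le_iff_countP (Finset.pairwise_sort _ _) (Finset.pairwise_sort _ _)]
  simp only [Finset.length_sort, Finset.card_image_of_injective _ (sub_right_injective_fin r),
    countP_sort_image]
  refine and_congr_right fun hc => ⟨fun h t => ?_, fun h x => h _⟩
  rcases t with _ | t
  · simp [shiftCount]
  · by_cases ht : t < n
    · exact h ⟨t, ht⟩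
    · rw [shiftCount_of_le r B (by omega), shiftCount_of_le r A (by omega), hc]

lemma shiftCount_add_prefixCount {n : ℕ} (r : Fin n) (A : Finset (Fin n)) {t : ℕ}
    (ht : r.val + t ≤ n) : shiftCount r A t + prefixCount A r = prefixCount A (r.val + t) := by
  unfold shiftCount prefixCount
  rw [← Finset.card_union_of_disjoint]
  · congr 1
    ext i
    simp only [Finset.mem_union, Finset.mem_filter, val_sub_eq]
    have := i.isLt
    by_cases hi : i ∈ A <;> simp only [hi, true_and, false_and, or_self]
    split_ifs <;> omega
  · rw [Finset.disjoint_left]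
    intro i
    simp only [Finset.mem_filter, val_sub_eq]
    have := i.isLt
    split_ifs <;> omega

/-- Here the first t elements after r wrap around past the end of `[n]`: they are the values from r
on, together with the values below r + t - n. -/
lemma shiftCount_add_prefixCount' {n : ℕ} (r : Fin n) (A : Finset (Fin n)) {t : ℕ}
    (ht : n ≤ r.val + t) (ht' : t ≤ n) :
    shiftCount r A t + prefixCount A r = A.card + prefixCount A (r.val + t - n) := by
  have hr := r.isLt
  have h1 : (A.filter fun i => (i - r).val < t) =
      (A.filter fun i => ¬ i.val < r.val) ∪ A.filter fun i => i.val < r.val + t - n := by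
    ext i
    simp only [Finset.mem_union, Finset.mem_filter, val_sub_eq]
    have := i.isLt
    by_cases hi : i ∈ A <;> simp only [hi, true_and, false_and, or_self]
    split_ifs <;> omega
  have h2 := Finset.card_filter_add_card_filter_not (s := A) (fun i => i.val < r.val)
  unfold shiftCount prefixCount
  rw [h1, Finset.card_union_of_disjoint]
  · omega
  · rw [Finset.disjoint_left]
    intro i
    simp only [Finset.mem_filter]
    omega

lemma prefixCount_of_le {n : ℕ} (A : Finset (Fin n)) {t : ℕ} (ht : n ≤ t) :
    prefixCount A t = A.card := by
  unfold prefixCount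
  rw [Finset.filter_true_of_mem]
  intro i _
  exact i.isLt.trans_le ht

lemma prefixCount_zero {n : ℕ} (A : Finset (Fin n)) : prefixCount A 0 = 0 := by
  simp [prefixCount]

/-- The difference of the counting functions of `B` and `A`. -/
def height {n : ℕ} (A B : Finset (Fin n)) (t : ℕ) : ℤ := prefixCount B t - prefixCount A t

lemma height_add {n : ℕ} (A B C : Finset (Fin n)) (t : ℕ) :
    height A B t + height B C t = height A C t := by
  unfold height; ring

/-- `A ≤_r B` if and only if `r` maximizes the height function. -/
lemma galeLE_iff_height {n : ℕ} {r : Fin n} {A B : Finset (Fin n)} :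
    GaleLE r A B ↔ A.card = B.card ∧ ∀ t ≤ n, height A B t ≤ height A B r := by
  rw [galeLE_iff_shiftCount]
  refine and_congr_right fun hc => ⟨fun h t ht => ?_, fun h t => ?_⟩
  · unfold height
    have hr := r.isLt
    by_cases hrt : r.val ≤ t
    · have h1 := shiftCount_add_prefixCount r A (t := t - r) (by omega)
      have h2 := shiftCount_add_prefixCount r B (t := t - r) (by omega)
      rw [Nat.add_sub_cancel' hrt] at h1 h2
      have := h (t - r)
      omega
    -- A value below r is reached from r only after wrapping around, hence n + t - r steps.
    · have h1 := shiftCount_add_prefixCount' r A (t := n + t - r) (by omega) (by omega)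
      have h2 := shiftCount_add_prefixCount' r B (t := n + t - r) (by omega) (by omega)
      rw [show r.val + (n + t - r) - n = t by omega] at h1 h2
      have := h (n + t - r)
      omega
  · unfold height at h
    by_cases htn : n ≤ t
    · rw [shiftCount_of_le r B htn, shiftCount_of_le r A htn, hc]
    by_cases hrt : r.val + t ≤ n
    · have h1 := shiftCount_add_prefixCount r A hrt
      have h2 := shiftCount_add_prefixCount r B hrt
      have := h _ hrt
      omega
    · have h1 := shiftCount_add_prefixCount' r A (t := t) (by omega) (by omega)
      have h2 := shiftCount_add_prefixCount' r B (t := t) (by omega) (by omega)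
      have := h (r.val + t - n) (by omega)
      omega

lemma GaleLE.card_eq {n : ℕ} {r : Fin n} {A B : Finset (Fin n)} (h : GaleLE r A B) :
    A.card = B.card := (galeLE_iff_height.1 h).1

lemma GaleLE.height_le {n : ℕ} {r : Fin n} {A B : Finset (Fin n)} (h : GaleLE r A B) {t : ℕ}
    (ht : t ≤ n) : height A B t ≤ height A B r := (galeLE_iff_height.1 h).2 t ht

lemma GaleLE.refl {n : ℕ} (r : Fin n) (A : Finset (Fin n)) : GaleLE r A A :=
  galeLE_iff_shiftCount.2 ⟨rfl, fun _ => le_rfl⟩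

lemma GaleLE.trans {n : ℕ} {r : Fin n} {A B C : Finset (Fin n)} (h : GaleLE r A B)
    (h' : GaleLE r B C) : GaleLE r A C := by
  rw [galeLE_iff_shiftCount] at *
  exact ⟨h.1.trans h'.1, fun t => (h'.2 t).trans (h.2 t)⟩

lemma mem_iff_shiftCount {n : ℕ} (r : Fin n) (A : Finset (Fin n)) (i : Fin n) :
    i ∈ A ↔ shiftCount r A (i - r).val < shiftCount r A ((i - r).val + 1) := by
  unfold shiftCount
  constructor
  · intro hi
    apply Finset.card_lt_card
    rw [Finset.ssubset_iff_of_subset]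
    · exact ⟨i, by simp [hi]⟩
    · intro j
      simp only [Finset.mem_filter]
      exact fun h => ⟨h.1, by omega⟩
  · intro h
    by_contra hi
    refine h.not_ge (Finset.card_le_card ?_)
    intro j
    simp only [Finset.mem_filter]
    rintro ⟨hj, h⟩
    refine ⟨hj, lt_of_le_of_ne (by omega) fun he => hi ?_⟩
    rwa [← val_sub_injective r he]

lemma eq_of_shiftCount_eq {n : ℕ} (r : Fin n) {A B : Finset (Fin n)}
    (h : ∀ t, shiftCount r A t = shiftCount r B t) : A = B := by
  ext i
  rw [mem_iff_shiftCount r, mem_iff_shiftCount r B, h, h]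

lemma GaleLE.antisymm {n : ℕ} {r : Fin n} {A B : Finset (Fin n)} (h : GaleLE r A B)
    (h' : GaleLE r B A) : A = B :=
  eq_of_shiftCount_eq r fun t => le_antisymm ((galeLE_iff_shiftCount.1 h').2 t)
    ((galeLE_iff_shiftCount.1 h).2 t)

/-- If `A ≤_r C ≤_r D ≤_r B`, then every `s` with `A ≤_s B` also has `C ≤_s D`. -/
lemma GaleLE.change {n : ℕ} {r s : Fin n} {A B C D : Finset (Fin n)} (h₁ : GaleLE r A C)
    (h₂ : GaleLE r C D) (h₃ : GaleLE r D B) (h : GaleLE s A B) : GaleLE s C D := by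
  refine galeLE_iff_height.2 ⟨h₂.card_eq, fun t ht => ?_⟩
  -- The heights of (A, C), (C, D) and (D, B) at s are at most those at r, and their sums at s and r
  -- agree because both maximize the height of (A, B). So equality holds in each.
  have e1 := height_add A C B s
  have e2 := height_add C D B s
  have e3 := height_add A C B r
  have e4 := height_add C D B r
  have := h.height_le r.isLt.le
  have := h₁.height_le s.isLt.le
  have := h₂.height_le s.isLt.le
  have := h₃.height_le s.isLt.le
  have := h₂.height_le ht
  omega

lemma height_zero {n : ℕ} (A B : Finset (Fin n)) : height A B 0 = 0 := by
  simp [height, prefixCount_zero]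

lemma height_self {n : ℕ} {A B : Finset (Fin n)} (h : A.card = B.card) : height A B n = 0 := by
  simp [height, prefixCount_of_le, h]

lemma galeLE_of_lt {n : ℕ} {r : Fin n} {A B : Finset (Fin n)} (hc : A.card = B.card)
    (h : ∀ t < n, height A B t ≤ height A B r) : GaleLE r A B := by
  refine galeLE_iff_height.2 ⟨hc, fun t ht => ?_⟩
  rcases ht.lt_or_eq with ht | rfl
  · exact h t ht
  -- The heights at 0 and at n both vanish, so the endpoint n, which is not in `Fin n`, adds no
  -- condition.
  · rw [height_self hc, ← height_zero A B]
    exact h 0 (Nat.zero_lt_of_lt r.isLt)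

lemma exists_galeLE {n : ℕ} (hn : 0 < n) {A B : Finset (Fin n)} (hc : A.card = B.card) :
    ∃ r, GaleLE r A B := by
  have : Nonempty (Fin n) := ⟨⟨0, hn⟩⟩
  obtain ⟨r, hr⟩ := Finite.exists_max fun r : Fin n => height A B r
  exact ⟨r, galeLE_of_lt hc fun t ht => hr ⟨t, ht⟩⟩

lemma prefixCount_insert {n : ℕ} {A : Finset (Fin n)} {p : Fin n} (hp : p ∉ A) (t : ℕ) :
    prefixCount (insert p A) t = prefixCount A t + if p.val < t then 1 else 0 := by
  unfold prefixCount
  rw [Finset.filter_insert]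
  split_ifs with h
  · rw [Finset.card_insert_of_notMem (by simp [hp])]
  · simp

/-- Adding one element to each of two sets keeps some common `r`. -/
lemma exists_galeLE_insert {n : ℕ} (hn : 0 < n) {A B : Finset (Fin n)} (hc : A.card = B.card)
    {p q : Fin n} (hp : p ∉ A) (hq : q ∉ B) :
    ∃ r, GaleLE r A B ∧ GaleLE r (insert p A) (insert q B) := by
  have : Nonempty (Fin n) := ⟨⟨0, hn⟩⟩
  have hc' : (insert p A).card = (insert q B).card := by
    rw [Finset.card_insert_of_notMem hp, Finset.card_insert_of_notMem hq, hc]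
  have key : ∀ t, height (insert p A) (insert q B) t =
      height A B t + ((if q.val < t then 1 else 0) - (if p.val < t then 1 else 0)) := by
    intro t
    unfold height
    rw [prefixCount_insert hp, prefixCount_insert hq]
    push_cast
    ring
  -- The new height is the old one plus a correction that takes at most two values, which are
  -- consecutive integers. If no maximizer of the old height maximizes the correction, all
  -- maximizers have the smaller correction; any other point loses at least 1 in the old height and
  -- gains at most 1.
  by_cases h : ∃ r : Fin n, (∀ s : Fin n, height A B s ≤ height A B r) ∧
      ∀ s : Fin n, ((if q.val < s.val then 1 else 0) - (if p.val < s.val then 1 else 0) : ℤ) ≤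
        (if q.val < r.val then 1 else 0) - (if p.val < r.val then 1 else 0)
  · obtain ⟨r, h1, h2⟩ := h
    refine ⟨r, galeLE_of_lt hc fun t ht => h1 ⟨t, ht⟩, galeLE_of_lt hc' fun t ht => ?_⟩
    rw [key, key]
    exact add_le_add (h1 ⟨t, ht⟩) (h2 ⟨t, ht⟩)
  · obtain ⟨r, hr⟩ := Finite.exists_max fun r : Fin n => height A B r
    refine ⟨r, galeLE_of_lt hc fun t ht => hr ⟨t, ht⟩, galeLE_of_lt hc' fun t ht => ?_⟩
    push Not at h
    rw [key, key]
    obtain ⟨s, hs⟩ := h r hr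
    have ht' := hr ⟨t, ht⟩
    simp only at ht'
    rcases ht'.lt_or_eq with hlt | heq
    · split_ifs at hs ⊢ <;> omega
    · obtain ⟨s', hs'⟩ := h ⟨t, ht⟩ (fun s => (hr s).trans heq.ge)
      simp only at hs'
      split_ifs at hs hs' ⊢ <;> omega

/-! ### The rank function of a subspace and its greedy bases -/

/-- The vectors whose coordinates in `S` vanish. -/
def coordKer {n : ℕ} (S : Finset (Fin n)) : Submodule ℂ (Fin n → ℂ) :=
  LinearMap.ker (LinearMap.funLeft ℂ ℂ (Subtype.val : {i // i ∈ S} → Fin n))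

lemma mem_coordKer {n : ℕ} {S : Finset (Fin n)} {x : Fin n → ℂ} :
    x ∈ coordKer S ↔ ∀ i ∈ S, x i = 0 := by
  unfold coordKer
  rw [LinearMap.mem_ker, funext_iff]
  simp [LinearMap.funLeft_apply]

lemma projDim_add {n : ℕ} (S : Finset (Fin n)) (V : Submodule ℂ (Fin n → ℂ)) :
    projDim S V + Module.finrank ℂ (V ⊓ coordKer S : Submodule ℂ (Fin n → ℂ)) =
      Module.finrank ℂ V := by
  have h := LinearMap.finrank_range_add_finrank_ker
    ((LinearMap.funLeft ℂ ℂ (Subtype.val : {i // i ∈ S} → Fin n)).domRestrict V)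
  rw [LinearMap.range_domRestrict, LinearMap.ker_domRestrict] at h
  rw [← h]
  unfold projDim
  congr 1
  have := LinearEquiv.finrank_eq (Submodule.equivSubtypeMap V
    (Submodule.comap V.subtype (coordKer S)))
  rw [Submodule.map_comap_subtype] at this
  exact this.symm

lemma coordKer_antitone {n : ℕ} {S T : Finset (Fin n)} (h : S ⊆ T) :
    coordKer T ≤ coordKer S := fun _ hx => mem_coordKer.2 fun i hi => mem_coordKer.1 hx i (h hi)

lemma projDim_mono {n : ℕ} {S T : Finset (Fin n)} (h : S ⊆ T) (V : Submodule ℂ (Fin n → ℂ)) :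
    projDim S V ≤ projDim T V := by
  have h1 := projDim_add S V
  have h2 := projDim_add T V
  have h3 : Module.finrank ℂ (V ⊓ coordKer T : Submodule ℂ (Fin n → ℂ)) ≤
      Module.finrank ℂ (V ⊓ coordKer S : Submodule ℂ (Fin n → ℂ)) :=
    Submodule.finrank_mono (inf_le_inf_left V (coordKer_antitone h))
  omega

lemma projDim_univ {n : ℕ} (V : Submodule ℂ (Fin n → ℂ)) :
    projDim Finset.univ V = Module.finrank ℂ V := by
  have h := projDim_add Finset.univ V
  have h0 : V ⊓ coordKer Finset.univ = ⊥ := by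
    rw [eq_bot_iff]
    rintro x ⟨_, hx⟩
    rw [Submodule.mem_bot]
    funext i
    exact mem_coordKer.1 hx i (Finset.mem_univ i)
  rwa [h0, finrank_bot, add_zero] at h

lemma projDim_le_card {n : ℕ} (S : Finset (Fin n)) (V : Submodule ℂ (Fin n → ℂ)) :
    projDim S V ≤ S.card := by
  unfold projDim
  refine (Submodule.finrank_le _).trans ?_
  simp

lemma projDim_empty {n : ℕ} (V : Submodule ℂ (Fin n → ℂ)) : projDim ∅ V = 0 :=
  Nat.le_zero.1 (projDim_le_card ∅ V)

/-- This is the dimension formula for the kernels of the projections restricted to V: their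
intersection is the kernel for S ∪ T, and their sum lies in the kernel for S ∩ T. -/
lemma projDim_submodular {n : ℕ} (S T : Finset (Fin n)) (V : Submodule ℂ (Fin n → ℂ)) :
    projDim (S ∪ T) V + projDim (S ∩ T) V ≤ projDim S V + projDim T V := by
  have h1 := projDim_add S V
  have h2 := projDim_add T V
  have h3 := projDim_add (S ∪ T) V
  have h4 := projDim_add (S ∩ T) V
  have h5 := Submodule.finrank_sup_add_finrank_inf_eq (V ⊓ coordKer S) (V ⊓ coordKer T)
  have h6 : V ⊓ coordKer S ⊓ (V ⊓ coordKer T) ≤ V ⊓ coordKer (S ∪ T) := by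
    rintro x ⟨⟨hV, hS⟩, _, hT⟩
    refine ⟨hV, mem_coordKer.2 fun i hi => ?_⟩
    rcases Finset.mem_union.1 hi with hi | hi
    · exact mem_coordKer.1 hS i hi
    · exact mem_coordKer.1 hT i hi
  have h7 : V ⊓ coordKer S ⊔ (V ⊓ coordKer T) ≤ V ⊓ coordKer (S ∩ T) :=
    sup_le (inf_le_inf_left V (coordKer_antitone Finset.inter_subset_left))
      (inf_le_inf_left V (coordKer_antitone Finset.inter_subset_right))
  have h8 := Submodule.finrank_mono h6
  have h9 := Submodule.finrank_mono h7
  omega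

/-- A set of coordinates that raises the rank for `V` also raises it for every larger subspace. -/
lemma projDim_lt_of_le {n : ℕ} {V W : Submodule ℂ (Fin n → ℂ)} (hVW : V ≤ W)
    {S T : Finset (Fin n)} (hST : S ⊆ T) (h : projDim S V < projDim T V) :
    projDim S W < projDim T W := by
  have hle := inf_le_inf_left V (coordKer_antitone hST)
  have h1 := projDim_add S V
  have h2 := projDim_add T V
  have h3 := projDim_add S W
  have h4 := projDim_add T W
  -- This vector of V vanishes on S but not on T, so it separates the two kernels inside W as well.
  obtain ⟨x, hx, hx'⟩ := SetLike.exists_of_lt (lt_of_le_of_ne hle fun he => by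
    rw [he] at h2; omega)
  have hlt : W ⊓ coordKer T < W ⊓ coordKer S :=
    lt_of_le_not_ge (inf_le_inf_left W (coordKer_antitone hST)) fun hge =>
      hx' ⟨hx.1, (hge ⟨hVW hx.1, hx.2⟩).2⟩
  have := Submodule.finrank_lt_finrank_of_lt hlt
  omega

/-- The bases of the matroid represented by `V`. -/
def IsCoordBasis {n : ℕ} (V : Submodule ℂ (Fin n → ℂ)) (I : Finset (Fin n)) : Prop :=
  I.card = Module.finrank ℂ V ∧ projDim I V = I.card

/-- Subsets of a basis are independent: by submodularity on I ∩ S and I \ S, the rank of I ∩ S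
cannot fall short of its size. -/
lemma IsCoordBasis.card_inter_le {n : ℕ} {V : Submodule ℂ (Fin n → ℂ)} {I : Finset (Fin n)}
    (h : IsCoordBasis V I) (S : Finset (Fin n)) : (I ∩ S).card ≤ projDim S V := by
  have h1 := projDim_submodular (I ∩ S) (I \ S) V
  rw [Finset.union_comm, Finset.sdiff_union_inter] at h1
  have h2 := projDim_le_card (I \ S) V
  have h3 := Finset.card_inter_add_card_sdiff I S
  have h4 := projDim_mono (Finset.inter_subset_right (s₁ := I) (s₂ := S)) V
  have := h.2
  omega

/-- The elements of position less than `t` with respect to a position function. -/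
def initSeg {n : ℕ} (pos : Fin n → ℕ) (t : ℕ) : Finset (Fin n) :=
  Finset.univ.filter fun i => pos i < t

lemma initSeg_mono {n : ℕ} (pos : Fin n → ℕ) {t t' : ℕ} (h : t ≤ t') :
    initSeg pos t ⊆ initSeg pos t' := by
  intro i
  simp only [initSeg, Finset.mem_filter]
  exact fun hi => ⟨hi.1, hi.2.trans_le h⟩

/-- The greedy basis of `V`: the positions where the rank of the initial segments jumps. -/
noncomputable def greedyBasis {n : ℕ} (pos : Fin n → ℕ) (V : Submodule ℂ (Fin n → ℂ)) :
    Finset (Fin n) :=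
  Finset.univ.filter fun e =>
    projDim (initSeg pos (pos e)) V < projDim (initSeg pos (pos e + 1)) V

lemma greedyBasis_mono {n : ℕ} (pos : Fin n → ℕ) {V W : Submodule ℂ (Fin n → ℂ)} (h : V ≤ W) :
    greedyBasis pos V ⊆ greedyBasis pos W := by
  intro e
  simp only [greedyBasis, Finset.mem_filter]
  exact fun he => ⟨he.1, projDim_lt_of_le h (initSeg_mono pos (Nat.le_succ _)) he.2⟩

/-- The greedy set spans each initial segment and is independent there. Both facts are carried
through the induction together: when e raises the rank of the segment, submodularity shows that it
raises the rank of the greedy part as well. -/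
lemma greedyBasis_inter {n : ℕ} {pos : Fin n → ℕ} (hpos : Function.Injective pos)
    (V : Submodule ℂ (Fin n → ℂ)) (t : ℕ) :
    projDim (greedyBasis pos V ∩ initSeg pos t) V = projDim (initSeg pos t) V ∧
      (greedyBasis pos V ∩ initSeg pos t).card = projDim (initSeg pos t) V := by
  induction t with
  | zero =>
    have : initSeg pos 0 = ∅ := by simp [initSeg]
    simp [this, projDim_empty]
  | succ t ih =>
    by_cases h : ∃ e, pos e = t
    · obtain ⟨e, rfl⟩ := h
      have hseg : initSeg pos (pos e + 1) = insert e (initSeg pos (pos e)) := by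
        ext i
        simp only [initSeg, Finset.mem_insert, Finset.mem_filter, Finset.mem_univ, true_and]
        rw [Nat.lt_succ_iff_lt_or_eq, hpos.eq_iff, or_comm]
      have hnot : e ∉ initSeg pos (pos e) := by simp [initSeg]
      by_cases he : e ∈ greedyBasis pos V
      · have hlt := (Finset.mem_filter.1 he).2
        have hI : greedyBasis pos V ∩ initSeg pos (pos e + 1) =
            insert e (greedyBasis pos V ∩ initSeg pos (pos e)) := by
          rw [hseg, Finset.inter_insert_of_mem he]
        have hsub := projDim_submodular (insert e (greedyBasis pos V ∩ initSeg pos (pos e)))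
          (initSeg pos (pos e)) V
        rw [Finset.insert_union, Finset.union_eq_right.2 Finset.inter_subset_right, ← hseg,
          Finset.insert_inter_of_notMem hnot, Finset.inter_assoc, Finset.inter_self] at hsub
        have hcard := projDim_le_card (insert e (greedyBasis pos V ∩ initSeg pos (pos e))) V
        rw [← hI] at hsub hcard
        have hmono := projDim_mono
          (Finset.inter_subset_right (s₁ := greedyBasis pos V) (s₂ := initSeg pos (pos e + 1))) V
        have hc : (greedyBasis pos V ∩ initSeg pos (pos e + 1)).card =
            (greedyBasis pos V ∩ initSeg pos (pos e)).card + 1 := by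
          rw [hI, Finset.card_insert_of_notMem fun h => hnot (Finset.mem_inter.1 h).2]
        omega
      · have hI : greedyBasis pos V ∩ initSeg pos (pos e + 1) =
            greedyBasis pos V ∩ initSeg pos (pos e) := by
          rw [hseg, Finset.inter_insert_of_notMem he]
        have hle : ¬ projDim (initSeg pos (pos e)) V < projDim (initSeg pos (pos e + 1)) V :=
          fun h => he (Finset.mem_filter.2 ⟨Finset.mem_univ e, h⟩)
        have := projDim_mono (initSeg_mono pos (Nat.le_add_right (pos e) 1)) V
        rw [hI]
        omega
    · have hseg : initSeg pos (t + 1) = initSeg pos t := by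
        ext i
        simp only [initSeg, Finset.mem_filter, Finset.mem_univ, true_and]
        have : pos i ≠ t := fun h' => h ⟨i, h'⟩
        omega
      rw [hseg]
      exact ih

lemma exists_initSeg_eq_univ {n : ℕ} (pos : Fin n → ℕ) :
    ∃ t, initSeg pos t = Finset.univ := by
  refine ⟨Finset.univ.sup pos + 1, ?_⟩
  unfold initSeg
  rw [Finset.filter_true_of_mem]
  intro i hi
  exact Nat.lt_succ_of_le (Finset.le_sup hi)

lemma isCoordBasis_greedyBasis {n : ℕ} {pos : Fin n → ℕ} (hpos : Function.Injective pos)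
    (V : Submodule ℂ (Fin n → ℂ)) : IsCoordBasis V (greedyBasis pos V) := by
  obtain ⟨t, ht⟩ := exists_initSeg_eq_univ pos
  have h := greedyBasis_inter hpos V t
  rw [ht, Finset.inter_univ, projDim_univ] at h
  exact ⟨h.2, h.1.trans h.2.symm⟩

/-! ### The rank conditions in terms of bases -/

lemma segFrom_eq_initSeg {n : ℕ} (r j : Fin n) :
    segFrom r j = initSeg (fun i => (i - r).val) ((j - r).val + 1) := by
  ext i
  simp only [segFrom, initSeg, ShiftLE, Finset.mem_filter, Fin.le_def, Nat.lt_succ_iff]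

/-- The position with respect to the reversed order. -/
def revPos {n : ℕ} (r i : Fin n) : ℕ := n - 1 - (i - r).val

lemma revPos_injective {n : ℕ} (r : Fin n) : Function.Injective (revPos r) := by
  intro i j h
  apply val_sub_injective r
  have := (i - r).isLt
  have := (j - r).isLt
  unfold revPos at h
  show (i - r).val = (j - r).val
  omega

lemma segTo_eq_initSeg {n : ℕ} (r j : Fin n) :
    segTo r j = initSeg (revPos r) (n - (j - r).val) := by
  ext i
  have := (i - r).isLt
  have := (j - r).isLt
  simp only [segTo, initSeg, ShiftLE, Finset.mem_filter, Finset.mem_univ, true_and, Fin.le_def]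
  unfold revPos
  omega

lemma shiftCount_eq_card_inter {n : ℕ} (r : Fin n) (A : Finset (Fin n)) (t : ℕ) :
    shiftCount r A t = (A ∩ initSeg (fun i => (i - r).val) t).card := by
  unfold shiftCount initSeg
  congr 1
  ext i
  simp

/-- Comparison of the numbers of elements in initial segments of `≤_r`. -/
lemma galeLE_iff_segFrom {n : ℕ} {r : Fin n} {A B : Finset (Fin n)} :
    GaleLE r A B ↔ A.card = B.card ∧
      ∀ j, (B ∩ segFrom r j).card ≤ (A ∩ segFrom r j).card := by
  rw [galeLE_iff_shiftCount]
  simp only [segFrom_eq_initSeg, ← shiftCount_eq_card_inter]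
  refine and_congr_right fun hc => ⟨fun h j => h _, fun h t => ?_⟩
  rcases t with _ | t
  · simp [shiftCount]
  · by_cases ht : t < n
    · have : NeZero n := ⟨by rintro rfl; exact r.elim0⟩
      -- The element at position t after r.
      have := h (⟨t, ht⟩ + r)
      rwa [add_sub_cancel_right] at this
    · rw [shiftCount_of_le r B (by omega), shiftCount_of_le r A (by omega), hc]

lemma card_inter_segTo_add {n : ℕ} (r j : Fin n) (A : Finset (Fin n)) :
    (A ∩ segTo r j).card + shiftCount r A (j - r).val = A.card := by
  rw [add_comm, ← Finset.card_filter_add_card_filter_not (s := A)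
    (fun i : Fin n => (i - r).val < (j - r).val)]
  unfold shiftCount
  congr 2
  ext i
  simp only [segTo, ShiftLE, Finset.mem_inter, Finset.mem_filter, Finset.mem_univ, true_and,
    Fin.le_def, not_lt]

/-- Comparison of the numbers of elements in final segments of `≤_r`. -/
lemma galeLE_iff_segTo {n : ℕ} {r : Fin n} {A B : Finset (Fin n)} :
    GaleLE r A B ↔ A.card = B.card ∧
      ∀ j, (A ∩ segTo r j).card ≤ (B ∩ segTo r j).card := by
  rw [galeLE_iff_shiftCount]
  refine and_congr_right fun hc => ⟨fun h j => ?_, fun h t => ?_⟩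
  · have := card_inter_segTo_add r j A
    have := card_inter_segTo_add r j B
    have := h (j - r).val
    omega
  · by_cases ht : t < n
    · have : NeZero n := ⟨by rintro rfl; exact r.elim0⟩
      have h1 := card_inter_segTo_add r (⟨t, ht⟩ + r) A
      have h2 := card_inter_segTo_add r (⟨t, ht⟩ + r) B
      have h3 := h (⟨t, ht⟩ + r)
      rw [add_sub_cancel_right] at h1 h2
      simp only at h1 h2
      omega
    · rw [shiftCount_of_le r B (by omega), shiftCount_of_le r A (by omega), hc]

/-- The basis of `V` that is minimal with respect to `≤_r`. -/
noncomputable def minBasis {n : ℕ} (r : Fin n) (V : Submodule ℂ (Fin n → ℂ)) :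
    Finset (Fin n) := greedyBasis (fun i => (i - r).val) V

/-- The basis of `V` that is maximal with respect to `≤_r`. -/
noncomputable def maxBasis {n : ℕ} (r : Fin n) (V : Submodule ℂ (Fin n → ℂ)) :
    Finset (Fin n) := greedyBasis (revPos r) V

lemma isCoordBasis_minBasis {n : ℕ} (r : Fin n) (V : Submodule ℂ (Fin n → ℂ)) :
    IsCoordBasis V (minBasis r V) := isCoordBasis_greedyBasis (val_sub_injective r) V

lemma isCoordBasis_maxBasis {n : ℕ} (r : Fin n) (V : Submodule ℂ (Fin n → ℂ)) :
    IsCoordBasis V (maxBasis r V) := isCoordBasis_greedyBasis (revPos_injective r) V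

lemma card_minBasis_inter {n : ℕ} (r j : Fin n) (V : Submodule ℂ (Fin n → ℂ)) :
    (minBasis r V ∩ segFrom r j).card = projDim (segFrom r j) V := by
  rw [segFrom_eq_initSeg]
  exact (greedyBasis_inter (val_sub_injective r) V _).2

lemma card_maxBasis_inter {n : ℕ} (r j : Fin n) (V : Submodule ℂ (Fin n → ℂ)) :
    (maxBasis r V ∩ segTo r j).card = projDim (segTo r j) V := by
  rw [segTo_eq_initSeg]
  exact (greedyBasis_inter (revPos_injective r) V _).2

/-- A basis meets each initial segment in at most as many elements as the rank of that segment, and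
the greedy basis attains this bound on all of them at once. -/
lemma IsCoordBasis.minBasis_le {n : ℕ} {V : Submodule ℂ (Fin n → ℂ)} {I : Finset (Fin n)}
    (h : IsCoordBasis V I) (r : Fin n) : GaleLE r (minBasis r V) I :=
  galeLE_iff_segFrom.2 ⟨(isCoordBasis_minBasis r V).1.trans h.1.symm, fun j => by
    rw [card_minBasis_inter]; exact h.card_inter_le _⟩

lemma IsCoordBasis.le_maxBasis {n : ℕ} {V : Submodule ℂ (Fin n → ℂ)} {I : Finset (Fin n)}
    (h : IsCoordBasis V I) (r : Fin n) : GaleLE r I (maxBasis r V) :=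
  galeLE_iff_segTo.2 ⟨h.1.trans (isCoordBasis_maxBasis r V).1.symm, fun j => by
    rw [card_maxBasis_inter]; exact h.card_inter_le _⟩

/-- The ranks of initial segments are the counting numbers of the least basis, so this and the next
three lemmas turn the conditions defining the varieties into comparisons of sets. -/
lemma projDim_segFrom_le_iff {n : ℕ} {r : Fin n} {V : Submodule ℂ (Fin n → ℂ)}
    {A : Finset (Fin n)} (hA : A.card = Module.finrank ℂ V) :
    (∀ j, projDim (segFrom r j) V ≤ (A ∩ segFrom r j).card) ↔ GaleLE r A (minBasis r V) := by
  rw [galeLE_iff_segFrom]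
  simp only [card_minBasis_inter, hA, (isCoordBasis_minBasis r V).1, true_and]

lemma projDim_segTo_le_iff {n : ℕ} {r : Fin n} {V : Submodule ℂ (Fin n → ℂ)}
    {B : Finset (Fin n)} (hB : B.card = Module.finrank ℂ V) :
    (∀ j, projDim (segTo r j) V ≤ (B ∩ segTo r j).card) ↔ GaleLE r (maxBasis r V) B := by
  rw [galeLE_iff_segTo]
  simp only [card_maxBasis_inter, hB, (isCoordBasis_maxBasis r V).1, true_and]

lemma projDim_segFrom_eq_iff {n : ℕ} {r : Fin n} {V : Submodule ℂ (Fin n → ℂ)}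
    {A : Finset (Fin n)} (hA : A.card = Module.finrank ℂ V) :
    (∀ j, projDim (segFrom r j) V = (A ∩ segFrom r j).card) ↔ A = minBasis r V := by
  constructor
  · intro h
    refine GaleLE.antisymm ((projDim_segFrom_le_iff hA).1 fun j => (h j).le)
      (galeLE_iff_segFrom.2 ⟨(isCoordBasis_minBasis r V).1.trans hA.symm, fun j => ?_⟩)
    rw [card_minBasis_inter, h]
  · rintro rfl j
    rw [card_minBasis_inter]

lemma projDim_segTo_eq_iff {n : ℕ} {r : Fin n} {V : Submodule ℂ (Fin n → ℂ)}
    {B : Finset (Fin n)} (hB : B.card = Module.finrank ℂ V) :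
    (∀ j, projDim (segTo r j) V = (B ∩ segTo r j).card) ↔ B = maxBasis r V := by
  constructor
  · intro h
    refine GaleLE.antisymm (galeLE_iff_segTo.2 ⟨hB.trans (isCoordBasis_maxBasis r V).1.symm,
      fun j => ?_⟩) ((projDim_segTo_le_iff hB).1 fun j => (h j).le)
    rw [card_maxBasis_inter, h]
  · rintro rfl j
    rw [card_maxBasis_inter]

/-! ### Sets of first values -/

lemma mem_firstValues {n : ℕ} {w : Equiv.Perm (Fin n)} {k : ℕ} {x : Fin n} :
    x ∈ firstValues w k ↔ (w.symm x).val < k := by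
  simp only [firstValues, Finset.mem_image, Finset.mem_filter, Finset.mem_univ, true_and]
  constructor
  · rintro ⟨i, hi, rfl⟩
    simpa using hi
  · exact fun h => ⟨w.symm x, h, by simp⟩

lemma firstValues_zero {n : ℕ} (w : Equiv.Perm (Fin n)) : firstValues w 0 = ∅ := by
  ext x
  simp [mem_firstValues]

lemma firstValues_self {n : ℕ} (w : Equiv.Perm (Fin n)) : firstValues w n = Finset.univ := by
  ext x
  simp [mem_firstValues]

lemma notMem_firstValues {n : ℕ} (w : Equiv.Perm (Fin n)) (i : Fin n) :
    w i ∉ firstValues w i := by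
  simp [mem_firstValues]

lemma firstValues_succ {n : ℕ} (w : Equiv.Perm (Fin n)) (i : Fin n) :
    firstValues w (i.val + 1) = insert (w i) (firstValues w i) := by
  ext x
  rw [Finset.mem_insert, mem_firstValues, mem_firstValues, Nat.lt_succ_iff_lt_or_eq, or_comm,
    ← Fin.ext_iff, Equiv.symm_apply_eq]

lemma card_firstValues {n : ℕ} (w : Equiv.Perm (Fin n)) {k : ℕ} (hk : k ≤ n) :
    (firstValues w k).card = k := by
  induction k with
  | zero => simp [firstValues_zero]
  | succ k ih =>
    have h := firstValues_succ w ⟨k, hk⟩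
    simp only at h
    rw [h, Finset.card_insert_of_notMem (notMem_firstValues w ⟨k, hk⟩)]
    simp only
    rw [ih (by omega)]

lemma eq_of_firstValues_eq {n : ℕ} {x y : Equiv.Perm (Fin n)}
    (h : ∀ k : Fin (n - 1), firstValues x (k + 1) = firstValues y (k + 1)) : x = y := by
  have h' : ∀ k ≤ n, firstValues x k = firstValues y k := by
    intro k hk
    rcases k with _ | k
    · rw [firstValues_zero, firstValues_zero]
    · rcases hk.lt_or_eq with hk | rfl
      · exact h ⟨k, by omega⟩
      · rw [firstValues_self, firstValues_self]
  ext i : 1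
  have h1 : x i ∈ firstValues y (i.val + 1) := by
    rw [← h' _ i.isLt, firstValues_succ]
    exact Finset.mem_insert_self _ _
  have h2 : x i ∉ firstValues y i := by
    rw [← h' _ i.isLt.le]
    exact notMem_firstValues x i
  rw [firstValues_succ] at h1
  exact (Finset.mem_insert.1 h1).resolve_right h2

lemma exists_perm_of_chain {n : ℕ} (S : ℕ → Finset (Fin n)) (hsub : ∀ k < n, S k ⊆ S (k + 1))
    (hcard : ∀ k ≤ n, (S k).card = k) :
    ∃ x : Equiv.Perm (Fin n), ∀ k ≤ n, firstValues x k = S k := by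
  have h : ∀ i : Fin n, ∃ e, e ∉ S i ∧ insert e (S i) = S (i.val + 1) := by
    intro i
    have h1 : (S (i.val + 1) \ S i).card = 1 := by
      rw [Finset.card_sdiff_of_subset (hsub i i.isLt), hcard _ i.isLt, hcard _ i.isLt.le]
      omega
    obtain ⟨e, he⟩ := Finset.card_eq_one.1 h1
    refine ⟨e, ?_, ?_⟩
    · have : e ∈ S (i.val + 1) \ S i := he ▸ Finset.mem_singleton_self e
      exact (Finset.mem_sdiff.1 this).2
    · rw [Finset.insert_eq, ← he, Finset.sdiff_union_of_subset (hsub i i.isLt)]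
  choose f hf hf' using h
  have hmono : ∀ m k, k + m ≤ n → S k ⊆ S (k + m) := by
    intro m
    induction m with
    | zero => intro k _; exact subset_rfl
    | succ m ih => intro k hk; exact (ih k (by omega)).trans (hsub (k + m) (by omega))
  have hne : ∀ i j : Fin n, i < j → f i ≠ f j := by
    intro i j hij he
    apply hf j
    rw [← he]
    have h1 : f i ∈ S (i.val + 1) := hf' i ▸ Finset.mem_insert_self _ _
    have h2 := hmono (j.val - (i.val + 1)) (i.val + 1) (by omega)
    rw [Nat.add_sub_cancel' (Nat.succ_le_of_lt hij)] at h2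
    exact h2 h1
  have hinj : Function.Injective f := by
    intro i j hij
    by_contra hne'
    rcases lt_or_gt_of_ne hne' with h | h
    · exact hne i j h hij
    · exact hne j i h hij.symm
  refine ⟨Equiv.ofBijective f (Finite.injective_iff_bijective.1 hinj), fun k hk => ?_⟩
  induction k with
  | zero =>
    rw [firstValues_zero]
    exact (Finset.card_eq_zero.1 (hcard 0 hk)).symm
  | succ k ih =>
    have h := firstValues_succ (Equiv.ofBijective f (Finite.injective_iff_bijective.1 hinj))
      ⟨k, hk⟩
    simp only at h
    rw [h, ih (by omega)]
    exact hf' ⟨k, hk⟩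

/-! ### Tilted Richardson varieties through bases -/

lemma finrank_step {n : ℕ} (F : CompleteFlag n) (k : Fin (n - 1)) :
    Module.finrank ℂ (F.step k) = k.val + 1 := F.finrank_space _

lemma card_firstValues_eq_finrank {n : ℕ} (w : Equiv.Perm (Fin n)) (F : CompleteFlag n)
    (k : Fin (n - 1)) : (firstValues w (k + 1)).card = Module.finrank ℂ (F.step k) := by
  rw [finrank_step, card_firstValues w (by omega)]

lemma mem_tiltedRichardsonWrt {n : ℕ} {a : Fin (n - 1) → Fin n} {u v : Equiv.Perm (Fin n)}
    {F : CompleteFlag n} : F ∈ tiltedRichardsonWrt a u v ↔ ∀ k,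
      GaleLE (a k) (firstValues u (k + 1)) (minBasis (a k) (F.step k)) ∧
      GaleLE (a k) (maxBasis (a k) (F.step k)) (firstValues v (k + 1)) := by
  simp only [tiltedRichardsonWrt, Set.mem_ofPred_eq, forall_and,
    projDim_segFrom_le_iff (card_firstValues_eq_finrank u F _),
    projDim_segTo_le_iff (card_firstValues_eq_finrank v F _)]

lemma mem_openTiltedRichardsonWrt {n : ℕ} {a : Fin (n - 1) → Fin n} {u v : Equiv.Perm (Fin n)}
    {F : CompleteFlag n} : F ∈ openTiltedRichardsonWrt a u v ↔ ∀ k : Fin (n - 1),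
      firstValues u (k + 1) = minBasis (a k) (F.step k) ∧
      firstValues v (k + 1) = maxBasis (a k) (F.step k) := by
  simp only [openTiltedRichardsonWrt, Set.mem_ofPred_eq, forall_and,
    projDim_segFrom_eq_iff (card_firstValues_eq_finrank u F _),
    projDim_segTo_eq_iff (card_firstValues_eq_finrank v F _)]

/-- In the chain A ≤_r `minBasis r V` ≤_r `minBasis s V` ≤_r B the middle comparison may be
transferred to s by `GaleLE.change`; minimality for s gives the reverse comparison. -/
lemma minBasis_eq {n : ℕ} {r s : Fin n} {V : Submodule ℂ (Fin n → ℂ)} {A B : Finset (Fin n)}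
    (hA : GaleLE r A (minBasis r V)) (hB : GaleLE r (maxBasis r V) B) (h : GaleLE s A B) :
    minBasis s V = minBasis r V := by
  have hs := isCoordBasis_minBasis s V
  exact ((isCoordBasis_minBasis r V).minBasis_le s).antisymm
    (hA.change (hs.minBasis_le r) ((hs.le_maxBasis r).trans hB) h)

lemma maxBasis_eq {n : ℕ} {r s : Fin n} {V : Submodule ℂ (Fin n → ℂ)} {A B : Finset (Fin n)}
    (hA : GaleLE r A (minBasis r V)) (hB : GaleLE r (maxBasis r V) B) (h : GaleLE s A B) :
    maxBasis s V = maxBasis r V := by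
  have hs := isCoordBasis_maxBasis s V
  exact ((hA.trans (hs.minBasis_le r)).change (hs.le_maxBasis r) hB h).antisymm
    ((isCoordBasis_maxBasis r V).le_maxBasis s)

lemma le_minBasis_change {n : ℕ} {r s : Fin n} {V : Submodule ℂ (Fin n → ℂ)}
    {A B : Finset (Fin n)} (hA : GaleLE r A (minBasis r V)) (hB : GaleLE r (maxBasis r V) B)
    (h : GaleLE s A B) : GaleLE s A (minBasis s V) ∧ GaleLE s (maxBasis s V) B := by
  have hm := (isCoordBasis_minBasis r V).le_maxBasis r
  rw [minBasis_eq hA hB h, maxBasis_eq hA hB h]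
  exact ⟨(GaleLE.refl r A).change hA (hm.trans hB) h,
    (hA.trans hm).change hB (GaleLE.refl r B) h⟩

lemma tiltedRichardsonWrt_subset {n : ℕ} {a b : Fin (n - 1) → Fin n}
    {u v : Equiv.Perm (Fin n)} (hb : SeqLE b u v) :
    tiltedRichardsonWrt a u v ⊆ tiltedRichardsonWrt b u v := by
  intro F hF
  rw [mem_tiltedRichardsonWrt] at hF ⊢
  exact fun k => le_minBasis_change (hF k).1 (hF k).2 (hb k)

lemma openTiltedRichardsonWrt_subset {n : ℕ} {a b : Fin (n - 1) → Fin n}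
    {u v : Equiv.Perm (Fin n)} (hb : SeqLE b u v) :
    openTiltedRichardsonWrt a u v ⊆ openTiltedRichardsonWrt b u v := by
  intro F hF
  rw [mem_openTiltedRichardsonWrt] at hF ⊢
  intro k
  obtain ⟨h1, h2⟩ := hF k
  have hA : GaleLE (a k) (firstValues u (k + 1)) (minBasis (a k) (F.step k)) :=
    h1 ▸ GaleLE.refl _ _
  have hB : GaleLE (a k) (maxBasis (a k) (F.step k)) (firstValues v (k + 1)) :=
    h2 ▸ GaleLE.refl _ _
  rw [minBasis_eq hA hB (hb k), maxBasis_eq hA hB (hb k)]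
  exact ⟨h1, h2⟩

lemma tiltedRichardsonWrt_eq {n : ℕ} {a : Fin (n - 1) → Fin n} {u v : Equiv.Perm (Fin n)}
    (ha : SeqLE a u v) : tiltedRichardsonWrt a u v = tiltedRichardson u v :=
  Set.Subset.antisymm (fun _ hF => ⟨a, ha, hF⟩)
    fun _ ⟨_, _, hF⟩ => tiltedRichardsonWrt_subset ha hF

lemma openTiltedRichardsonWrt_eq {n : ℕ} {a : Fin (n - 1) → Fin n} {u v : Equiv.Perm (Fin n)}
    (ha : SeqLE a u v) : openTiltedRichardsonWrt a u v = openTiltedRichardson u v :=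
  Set.Subset.antisymm (fun _ hF => ⟨a, ha, hF⟩)
    fun _ ⟨_, _, hF⟩ => openTiltedRichardsonWrt_subset ha hF

lemma exists_seqLE {n : ℕ} (u v : Equiv.Perm (Fin n)) :
    ∃ a : Fin (n - 1) → Fin n, SeqLE a u v := by
  have h : ∀ k : Fin (n - 1), ∃ r,
      GaleLE r (firstValues u (k + 1)) (firstValues v (k + 1)) := fun k =>
    exists_galeLE (by have := k.isLt; omega) (by
      rw [card_firstValues u (by omega), card_firstValues v (by omega)])
  choose a ha using h
  exact ⟨a, ha⟩

lemma SeqLE.trans {n : ℕ} {a : Fin (n - 1) → Fin n} {u v w : Equiv.Perm (Fin n)}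
    (h : SeqLE a u v) (h' : SeqLE a v w) : SeqLE a u w := fun k => (h k).trans (h' k)

lemma SeqLE.refl {n : ℕ} (a : Fin (n - 1) → Fin n) (u : Equiv.Perm (Fin n)) : SeqLE a u u :=
  fun _ => GaleLE.refl _ _

lemma GaleLE.of_card {n : ℕ} {r : Fin n} {A B : Finset (Fin n)} (h : A.card = B.card)
    (h' : A.card = 0 ∨ A.card = n) : GaleLE r A B := by
  have : A = B := by
    rcases h' with h' | h'
    · rw [Finset.card_eq_zero.1 h', Finset.card_eq_zero.1 (h.symm.trans h')]
    · rw [(Finset.card_eq_iff_eq_univ A).1 (by simpa using h'),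
        (Finset.card_eq_iff_eq_univ B).1 (by simpa using h.symm.trans h')]
  exact this ▸ GaleLE.refl r A

/-- Each flag of a tilted Richardson variety lies in one of the open strata. -/
lemma exists_mem_openTiltedRichardsonWrt {n : ℕ} {a : Fin (n - 1) → Fin n}
    {u v : Equiv.Perm (Fin n)} (ha : SeqLE a u v) {F : CompleteFlag n}
    (hF : F ∈ tiltedRichardsonWrt a u v) :
    ∃ x y, SeqLE a u x ∧ SeqLE a x y ∧ SeqLE a y v ∧ F ∈ openTiltedRichardsonWrt a x y := by
  rcases Nat.eq_zero_or_pos n with rfl | hn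
  · exact ⟨u, v, SeqLE.refl a u, ha, SeqLE.refl a v, fun k => k.elim0⟩
  rw [mem_tiltedRichardsonWrt] at hF
  -- Beyond n the sequence is constant, so that it is defined on all of ℕ.
  set V : ℕ → Submodule ℂ (Fin n → ℂ) := fun k => F.space ⟨min k n, by omega⟩ with hVdef
  have hVmono : ∀ k, V k ≤ V (k + 1) := fun k => F.mono (by
    rw [Fin.mk_le_mk]; omega)
  have hVrank : ∀ k ≤ n, Module.finrank ℂ (V k) = k := fun k hk => by
    rw [hVdef, F.finrank_space]
    simp [hk]
  have hVstep : ∀ k : Fin (n - 1), V (k.val + 1) = F.step k := fun k => by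
    simp only [hVdef, CompleteFlag.step]
    congr 2
    omega
  -- The bounds hold for every admissible r, and also at the levels 0 and n, where sets of that size
  -- are unique.
  have hbd : ∀ k ≤ n, ∀ r, GaleLE r (firstValues u k) (firstValues v k) →
      GaleLE r (firstValues u k) (minBasis r (V k)) ∧
      GaleLE r (maxBasis r (V k)) (firstValues v k) := by
    intro k hk r hr
    by_cases hk' : 0 < k ∧ k < n
    · obtain ⟨k, rfl⟩ := Nat.exists_eq_succ_of_ne_zero hk'.1.ne'
      have h := hF ⟨k, by omega⟩
      rw [← hVstep] at h
      exact le_minBasis_change h.1 h.2 hr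
    · have h1 := (isCoordBasis_minBasis r (V k)).1
      have h2 := (isCoordBasis_maxBasis r (V k)).1
      have h3 := card_firstValues u hk
      have h4 := card_firstValues v hk
      rw [hVrank k hk] at h1 h2
      exact ⟨GaleLE.of_card (by omega) (by omega), GaleLE.of_card (by omega) (by omega)⟩
  have hb : ∀ k, ∃ r, k ≤ n → GaleLE r (firstValues u k) (firstValues v k) := by
    intro k
    by_cases hk : k ≤ n
    · obtain ⟨r, hr⟩ := exists_galeLE hn
        ((card_firstValues u hk).trans (card_firstValues v hk).symm)
      exact ⟨r, fun _ => hr⟩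
    · exact ⟨⟨0, hn⟩, fun h => absurd h hk⟩
  choose b hb using hb
  have hcommon : ∀ k < n, ∃ r, GaleLE r (firstValues u k) (firstValues v k) ∧
      GaleLE r (firstValues u (k + 1)) (firstValues v (k + 1)) := by
    intro k hk
    have h1 := firstValues_succ u ⟨k, hk⟩
    have h2 := firstValues_succ v ⟨k, hk⟩
    simp only at h1 h2
    rw [h1, h2]
    exact exists_galeLE_insert hn
      ((card_firstValues u hk.le).trans (card_firstValues v hk.le).symm)
      (notMem_firstValues u ⟨k, hk⟩) (notMem_firstValues v ⟨k, hk⟩)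
  -- The bases at levels k and k + 1 are defined by unrelated orders `b k` and `b (k + 1)`. Both may
  -- be replaced by an order common to the two levels, for which greedy bases are monotone in the
  -- subspace.
  obtain ⟨x, hx⟩ := exists_perm_of_chain (fun k => minBasis (b k) (V k)) (by
      intro k hk
      obtain ⟨r, h1, h2⟩ := hcommon k hk
      have e1 := hbd k hk.le r h1
      have e2 := hbd (k + 1) hk r h2
      rw [minBasis_eq e1.1 e1.2 (hb k hk.le), minBasis_eq e2.1 e2.2 (hb (k + 1) hk)]
      exact greedyBasis_mono _ (hVmono k))
    (fun k hk => (isCoordBasis_minBasis _ _).1.trans (hVrank k hk))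
  obtain ⟨y, hy⟩ := exists_perm_of_chain (fun k => maxBasis (b k) (V k)) (by
      intro k hk
      obtain ⟨r, h1, h2⟩ := hcommon k hk
      have e1 := hbd k hk.le r h1
      have e2 := hbd (k + 1) hk r h2
      rw [maxBasis_eq e1.1 e1.2 (hb k hk.le), maxBasis_eq e2.1 e2.2 (hb (k + 1) hk)]
      exact greedyBasis_mono _ (hVmono k))
    (fun k hk => (isCoordBasis_maxBasis _ _).1.trans (hVrank k hk))
  have hx' : ∀ k : Fin (n - 1), firstValues x (k + 1) = minBasis (a k) (F.step k) := by
    intro k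
    rw [hx _ (by omega), hVstep]
    exact minBasis_eq (hF k).1 (hF k).2 (hb _ (by omega))
  have hy' : ∀ k : Fin (n - 1), firstValues y (k + 1) = maxBasis (a k) (F.step k) := by
    intro k
    rw [hy _ (by omega), hVstep]
    exact maxBasis_eq (hF k).1 (hF k).2 (hb _ (by omega))
  refine ⟨x, y, fun k => ?_, fun k => ?_, fun k => ?_, ?_⟩
  · rw [hx']; exact (hF k).1
  · rw [hx', hy']; exact (isCoordBasis_minBasis _ _).le_maxBasis _
  · rw [hy']; exact (hF k).2
  · exact mem_openTiltedRichardsonWrt.2 fun k => ⟨hx' k, hy' k⟩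

/-! ### Lengths of permutations and transpositions -/

lemma length_eq_sum {n : ℕ} (w : Equiv.Perm (Fin n)) :
    (length w : ℤ) = ∑ a, ∑ b, (if w b < w a then 1 else 0) * (if a < b then 1 else 0) := by
  rw [← Finset.sum_product']
  unfold length
  rw [Finset.card_filter]
  push_cast
  refine Finset.sum_congr rfl fun p _ => ?_
  split_ifs <;> simp_all

/-- Reindexing by the involution t leaves the factor for the values of w unchanged, so a difference
of lengths only involves changes in the order of positions. -/
lemma length_mul_eq_sum {n : ℕ} (w t : Equiv.Perm (Fin n)) (ht : ∀ a, t (t a) = a) :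
    (length (w * t) : ℤ) =
      ∑ a, ∑ b, (if w b < w a then 1 else 0) * (if t a < t b then 1 else 0) := by
  rw [length_eq_sum, ← Equiv.sum_comp t]
  refine Finset.sum_congr rfl fun a _ => ?_
  rw [← Equiv.sum_comp t]
  refine Finset.sum_congr rfl fun b _ => ?_
  simp only [Equiv.Perm.mul_apply, ht]

/-- Only the pair i, j itself and the pairs of i or j with a position strictly between them change
their order. -/
lemma swap_lt_sub_lt {n : ℕ} {i j : Fin n} (hij : i < j) (a b : Fin n) :
    ((if Equiv.swap i j a < Equiv.swap i j b then 1 else 0) - (if a < b then 1 else 0) : ℤ) =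
      (if a = j then ((if b = i then 1 else 0) + if i < b ∧ b < j then 1 else 0) else 0) -
      (if a = i then ((if b = j then 1 else 0) + if i < b ∧ b < j then 1 else 0) else 0) +
      (if b = i then (if i < a ∧ a < j then 1 else 0) else 0) -
      (if b = j then (if i < a ∧ a < j then 1 else 0) else 0) := by
  rw [Equiv.swap_apply_def, Equiv.swap_apply_def]
  simp only [Fin.ext_iff, Fin.lt_def] at *
  by_cases h1 : a.val = i.val <;> by_cases h2 : a.val = j.val <;>
    by_cases h3 : b.val = i.val <;> by_cases h4 : b.val = j.val <;>
    simp only [h1, h2, h3, h4, if_true, if_false] <;> split_ifs <;> omega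

/-- The positions strictly between `i` and `j` whose values lie between `w i` and `w j`. -/
def between {n : ℕ} (w : Equiv.Perm (Fin n)) (i j : Fin n) : Finset (Fin n) :=
  (Finset.Ioo i j).filter fun l => (w i < w l ∧ w l < w j) ∨ (w j < w l ∧ w l < w i)

lemma length_mul_swap {n : ℕ} {w : Equiv.Perm (Fin n)} {i j : Fin n} (hij : i < j)
    (hw : w i < w j) :
    length (w * Equiv.swap i j) = length w + 1 + 2 * (between w i j).card := by
  have h1 := length_mul_eq_sum w (Equiv.swap i j) (Equiv.swap_apply_self i j)
  have h2 := length_eq_sum w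
  -- The pair i, j contributes 1. A position l strictly between contributes 2 if its value lies
  -- between w i and w j, and 0 otherwise.
  have h3 : (length (w * Equiv.swap i j) : ℤ) - length w =
      1 + ∑ l, if i < l ∧ l < j then
        (((if w l < w j then 1 else 0) - if w l < w i then 1 else 0) +
        ((if w i < w l then 1 else 0) - if w j < w l then 1 else 0) : ℤ) else 0 := by
    rw [h1, h2, ← Finset.sum_sub_distrib]
    simp only [← Finset.sum_sub_distrib, ← mul_sub, swap_lt_sub_lt hij]
    simp only [mul_add, mul_sub, Finset.sum_add_distrib, Finset.sum_sub_distrib, mul_ite, mul_one,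
      mul_zero, Finset.sum_ite_irrel, Finset.sum_ite_eq', Finset.mem_univ, if_true,
      Finset.sum_const_zero]
    rw [if_pos hw, if_neg hw.not_gt]
    have h : ∀ (P : Fin n → Prop) [DecidablePred P] (f g : Fin n → ℤ),
        (∑ l, if P l then f l + g l else 0) =
          (∑ l, if P l then f l else 0) + ∑ l, if P l then g l else 0 := by
      intro P _ f g
      rw [← Finset.sum_add_distrib]
      exact Finset.sum_congr rfl fun l _ => by split_ifs <;> simp
    have h' : ∀ (P : Fin n → Prop) [DecidablePred P] (f g : Fin n → ℤ),
        (∑ l, if P l then f l - g l else 0) =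
          (∑ l, if P l then f l else 0) - ∑ l, if P l then g l else 0 := by
      intro P _ f g
      rw [← Finset.sum_sub_distrib]
      exact Finset.sum_congr rfl fun l _ => by split_ifs <;> simp
    rw [h, h', h']
    ring
  have h4 : (∑ l, if i < l ∧ l < j then
        (((if w l < w j then 1 else 0) - if w l < w i then 1 else 0) +
        ((if w i < w l then 1 else 0) - if w j < w l then 1 else 0) : ℤ) else 0) =
      2 * ((between w i j).card : ℤ) := by
    have : between w i j = Finset.univ.filter fun l => (i < l ∧ l < j) ∧
        ((w i < w l ∧ w l < w j) ∨ (w j < w l ∧ w l < w i)) := by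
      ext l
      simp [between]
    rw [this, Finset.card_filter]
    push_cast
    rw [Finset.mul_sum]
    refine Finset.sum_congr rfl fun l _ => ?_
    by_cases hl : i < l ∧ l < j
    · have hi : w l ≠ w i := fun h => hl.1.ne' (w.injective h)
      have hj : w l ≠ w j := fun h => hl.2.ne (w.injective h)
      simp only [hl, true_and, if_true]
      simp only [Fin.lt_def, ne_eq, Fin.ext_iff] at *
      split_ifs <;> omega
    · simp [hl]
  rw [h4] at h3
  omega

lemma length_mul_swap' {n : ℕ} {w : Equiv.Perm (Fin n)} {i j : Fin n} (hij : i < j)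
    (hw : w j < w i) :
    length w = length (w * Equiv.swap i j) + 1 + 2 * (between w i j).card := by
  have h := length_mul_swap (w := w * Equiv.swap i j) hij (by simpa using hw)
  rw [mul_assoc, Equiv.swap_mul_self, mul_one] at h
  rw [h]
  congr 2
  unfold between
  congr 1
  apply Finset.filter_congr
  intro l hl
  rw [Finset.mem_Ioo] at hl
  simp only [Equiv.Perm.mul_apply, Equiv.swap_apply_left, Equiv.swap_apply_right,
    Equiv.swap_apply_of_ne_of_ne hl.1.ne' hl.2.ne]
  exact or_comm

lemma length_le {n : ℕ} (w : Equiv.Perm (Fin n)) : length w ≤ n * n := by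
  refine (Finset.card_filter_le _ _).trans ?_
  simp

/-! ### The maximal height -/

/-- The maximum of the height function. -/
def supHeight {n : ℕ} (A B : Finset (Fin n)) : ℤ :=
  (Finset.range (n + 1)).sup' ⟨0, by simp⟩ (height A B)

lemma height_le_supHeight {n : ℕ} (A B : Finset (Fin n)) {t : ℕ} (ht : t ≤ n) :
    height A B t ≤ supHeight A B :=
  Finset.le_sup' (height A B) (Finset.mem_range.2 (Nat.lt_succ_of_le ht))

lemma supHeight_le {n : ℕ} {A B : Finset (Fin n)} {c : ℤ} (h : ∀ t ≤ n, height A B t ≤ c) :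
    supHeight A B ≤ c :=
  Finset.sup'_le _ _ fun t ht => h t (Nat.le_of_lt_succ (Finset.mem_range.1 ht))

lemma supHeight_nonneg {n : ℕ} (A B : Finset (Fin n)) : 0 ≤ supHeight A B := by
  have := height_le_supHeight A B (Nat.zero_le n)
  rwa [height_zero] at this

lemma supHeight_triangle {n : ℕ} (A B C : Finset (Fin n)) :
    supHeight A C ≤ supHeight A B + supHeight B C :=
  supHeight_le fun t ht => by
    rw [← height_add A B C]
    exact add_le_add (height_le_supHeight A B ht) (height_le_supHeight B C ht)

lemma GaleLE.supHeight_eq {n : ℕ} {r : Fin n} {A B : Finset (Fin n)} (h : GaleLE r A B) :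
    supHeight A B = height A B r :=
  le_antisymm (supHeight_le fun _ ht => h.height_le ht) (height_le_supHeight A B r.isLt.le)

lemma supHeight_add {n : ℕ} {r : Fin n} {A B C : Finset (Fin n)} (h : GaleLE r A B)
    (h' : GaleLE r B C) : supHeight A B + supHeight B C = supHeight A C := by
  rw [h.supHeight_eq, h'.supHeight_eq, (h.trans h').supHeight_eq, height_add]

/-- At r the heights of (A, B) and (B, C) sum to the maximal height of (A, C), which by hypothesis
is the sum of their own maxima; so each attains its maximum at r. -/
lemma galeLE_of_supHeight_add {n : ℕ} {r : Fin n} {A B C : Finset (Fin n)}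
    (hc : A.card = B.card) (h : GaleLE r A C)
    (h' : supHeight A B + supHeight B C = supHeight A C) : GaleLE r A B ∧ GaleLE r B C := by
  rw [h.supHeight_eq, ← height_add A B C] at h'
  have h1 := height_le_supHeight A B r.isLt.le
  have h2 := height_le_supHeight B C r.isLt.le
  refine ⟨galeLE_iff_height.2 ⟨hc, fun t ht => ?_⟩,
    galeLE_iff_height.2 ⟨hc.symm.trans h.card_eq, fun t ht => ?_⟩⟩
  · have := height_le_supHeight A B ht
    omega
  · have := height_le_supHeight B C ht
    omega

/-! ### Swapping two values -/

lemma firstValues_mul_swap_of_not {n : ℕ} (w : Equiv.Perm (Fin n)) {i j : Fin n} (hij : i < j)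
    {k : ℕ} (hk : ¬ (i.val ≤ k ∧ k < j.val)) :
    firstValues (w * Equiv.swap i j) (k + 1) = firstValues w (k + 1) := by
  ext x
  rw [mem_firstValues, mem_firstValues]
  have : (w * Equiv.swap i j).symm x = Equiv.swap i j (w.symm x) := rfl
  rw [this, Equiv.swap_apply_def]
  rw [Fin.lt_def] at hij
  split_ifs with h1 h2
  · rw [h1]; omega
  · rw [h2]; omega
  · rfl

/-- The common part of `w[k+1]` and `(w tᵢⱼ)[k+1]` for `i ≤ k < j`. -/
lemma firstValues_mul_swap {n : ℕ} (w : Equiv.Perm (Fin n)) {i j : Fin n}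
    {k : ℕ} (hik : i.val ≤ k) (hkj : k < j.val) :
    ∃ C : Finset (Fin n), w i ∉ C ∧ w j ∉ C ∧ firstValues w (k + 1) = insert (w i) C ∧
      firstValues (w * Equiv.swap i j) (k + 1) = insert (w j) C := by
  refine ⟨(firstValues w (k + 1)).erase (w i), Finset.notMem_erase _ _, ?_, ?_, ?_⟩
  · simp only [Finset.mem_erase, mem_firstValues, Equiv.symm_apply_apply]
    omega
  · rw [Finset.insert_erase]
    simp only [mem_firstValues, Equiv.symm_apply_apply]
    omega
  · ext x
    simp only [Finset.mem_insert, Finset.mem_erase, mem_firstValues]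
    have : (w * Equiv.swap i j).symm x = Equiv.swap i j (w.symm x) := rfl
    rw [this, Equiv.swap_apply_def, ← Equiv.symm_apply_eq, ne_eq, ← Equiv.symm_apply_eq]
    split_ifs with h1 h2
    · rw [h1]
      have : i ≠ j := fun h => by rw [h] at hik; omega
      simp [this]
      omega
    · simp [h2]; omega
    · simp [h1, h2]

lemma supHeight_self {n : ℕ} (A : Finset (Fin n)) : supHeight A A = 0 :=
  le_antisymm (supHeight_le fun t _ => by simp [height]) (supHeight_nonneg A A)

lemma supHeight_mul_swap {n : ℕ} (w : Equiv.Perm (Fin n)) {i j : Fin n} (hij : i < j) (k : ℕ) :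
    supHeight (firstValues w (k + 1)) (firstValues (w * Equiv.swap i j) (k + 1)) =
      if i.val ≤ k ∧ k < j.val then (if w i < w j then 0 else 1) else 0 := by
  by_cases hk : i.val ≤ k ∧ k < j.val
  · rw [if_pos hk]
    obtain ⟨C, hi, hj, h1, h2⟩ := firstValues_mul_swap w hk.1 hk.2
    have key : ∀ t, height (firstValues w (k + 1)) (firstValues (w * Equiv.swap i j) (k + 1)) t =
        (if (w j).val < t then 1 else 0) - if (w i).val < t then 1 else 0 := by
      intro t
      rw [h1, h2, height, prefixCount_insert hi, prefixCount_insert hj]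
      push_cast
      ring
    split_ifs with hw
    · refine le_antisymm (supHeight_le fun t _ => ?_) (supHeight_nonneg _ _)
      rw [key]
      rw [Fin.lt_def] at hw
      split_ifs <;> omega
    · refine le_antisymm (supHeight_le fun t _ => ?_) ?_
      · rw [key]
        split_ifs <;> omega
      -- For w j < w i the height is 1 exactly on w j < t ≤ w i; the maximum is read off at t = w i.
      · have := height_le_supHeight (firstValues w (k + 1))
          (firstValues (w * Equiv.swap i j) (k + 1)) (w i).isLt.le
        rw [key] at this
        have hne : (w i).val ≠ (w j).val := fun h => hij.ne (w.injective (Fin.ext h))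
        rw [Fin.lt_def] at hw
        rw [if_pos (by omega), if_neg (lt_irrefl _)] at this
        exact this
  · rw [if_neg hk, firstValues_mul_swap_of_not w hij hk, supHeight_self]

/-! ### The length of shortest paths -/

/-- The length of a shortest path, in terms of lengths and heights. -/
def pathLength {n : ℕ} (u v : Equiv.Perm (Fin n)) : ℤ :=
  length v - length u +
    2 * ∑ k : Fin (n - 1), supHeight (firstValues u (k + 1)) (firstValues v (k + 1))

lemma pathLength_self {n : ℕ} (u : Equiv.Perm (Fin n)) : pathLength u u = 0 := by
  simp [pathLength, supHeight_self]

lemma pathLength_triangle {n : ℕ} (u w v : Equiv.Perm (Fin n)) :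
    pathLength u v ≤ pathLength u w + pathLength w v := by
  have : ∑ k : Fin (n - 1), supHeight (firstValues u (k + 1)) (firstValues v (k + 1)) ≤
      ∑ k : Fin (n - 1), supHeight (firstValues u (k + 1)) (firstValues w (k + 1)) +
      ∑ k : Fin (n - 1), supHeight (firstValues w (k + 1)) (firstValues v (k + 1)) := by
    rw [← Finset.sum_add_distrib]
    exact Finset.sum_le_sum fun k _ => supHeight_triangle _ _ _
  unfold pathLength
  omega

lemma pathLength_add {n : ℕ} {a : Fin (n - 1) → Fin n} {u w v : Equiv.Perm (Fin n)}
    (h : SeqLE a u w) (h' : SeqLE a w v) :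
    pathLength u w + pathLength w v = pathLength u v := by
  have : ∑ k : Fin (n - 1), supHeight (firstValues u (k + 1)) (firstValues v (k + 1)) =
      ∑ k : Fin (n - 1), supHeight (firstValues u (k + 1)) (firstValues w (k + 1)) +
      ∑ k : Fin (n - 1), supHeight (firstValues w (k + 1)) (firstValues v (k + 1)) := by
    rw [← Finset.sum_add_distrib]
    exact Finset.sum_congr rfl fun k _ => (supHeight_add (h k) (h' k)).symm
  unfold pathLength
  omega

/-- Equality of the totals forces equality in the triangle inequality for the maximal heights at
every level. -/
lemma seqLE_of_pathLength_add {n : ℕ} {a : Fin (n - 1) → Fin n} {u w v : Equiv.Perm (Fin n)}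
    (h : SeqLE a u v) (h' : pathLength u w + pathLength w v = pathLength u v) :
    SeqLE a u w ∧ SeqLE a w v := by
  have hsum : ∑ k : Fin (n - 1), supHeight (firstValues u (k + 1)) (firstValues v (k + 1)) =
      ∑ k : Fin (n - 1), (supHeight (firstValues u (k + 1)) (firstValues w (k + 1)) +
        supHeight (firstValues w (k + 1)) (firstValues v (k + 1))) := by
    rw [Finset.sum_add_distrib]
    unfold pathLength at h'
    omega
  rw [Finset.sum_eq_sum_iff_of_le fun k _ => supHeight_triangle _ _ _] at hsum
  have key := fun k => galeLE_of_supHeight_add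
    ((card_firstValues u (by omega)).trans (card_firstValues w (by omega)).symm) (h k)
    (hsum k (Finset.mem_univ k)).symm
  exact ⟨fun k => (key k).1, fun k => (key k).2⟩

lemma sum_supHeight_mul_swap {n : ℕ} (w : Equiv.Perm (Fin n)) {i j : Fin n} (hij : i < j) :
    ∑ k : Fin (n - 1), supHeight (firstValues w (k + 1))
      (firstValues (w * Equiv.swap i j) (k + 1)) =
      if w i < w j then 0 else ((j.val - i.val : ℕ) : ℤ) := by
  simp only [supHeight_mul_swap w hij]
  split_ifs with hw
  · simp
  · rw [← Finset.sum_filter, Finset.sum_const, nsmul_eq_mul, mul_one, Nat.cast_inj,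
      ← Nat.card_Ico i.val j.val]
    refine Finset.card_bij (fun k _ => k.val) ?_ ?_ ?_
    · intro k hk
      simpa using hk
    · intro k _ k' _ h
      exact Fin.ext h
    · intro k hk
      rw [Finset.mem_Ico] at hk
      exact ⟨⟨k, by omega⟩, by simpa using hk, rfl⟩

/-- An edge with w i < w j raises the length by 1 and has maximal height 0 at all levels. If w j < w
i, the length changes by 1 - 2(j - i), and the j - i levels where the sets differ give back 2(j -
i). -/
lemma QBGEdge.pathLength_eq {n : ℕ} {w w' : Equiv.Perm (Fin n)} (h : QBGEdge w w') :
    pathLength w w' = 1 := by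
  obtain ⟨i, j, hij, rfl, h⟩ := h
  unfold pathLength
  rw [sum_supHeight_mul_swap w hij]
  have hij' := hij
  rw [Fin.lt_def] at hij'
  rcases lt_trichotomy (w i) (w j) with hw | hw | hw
  · rw [if_pos hw]
    have := length_mul_swap hij hw
    omega
  · exact absurd (w.injective hw) hij.ne
  · rw [if_neg hw.not_gt]
    have := length_mul_swap' hij hw
    omega

lemma HasPath.pathLength_le {n : ℕ} {u v : Equiv.Perm (Fin n)} {k : ℕ} (h : HasPath u v k) :
    pathLength u v ≤ k := by
  obtain ⟨p, rfl, rfl, hp⟩ := h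
  induction k with
  | zero => simp [pathLength_self]
  | succ k ih =>
    have h1 := ih fun i hi => hp i (by omega)
    have h2 := (hp k (by omega)).pathLength_eq
    have h3 := pathLength_triangle (p 0) (p k) (p (k + 1))
    push_cast
    omega

lemma HasPath.cons {n : ℕ} {u w v : Equiv.Perm (Fin n)} {k : ℕ} (h : QBGEdge u w)
    (h' : HasPath w v k) : HasPath u v (k + 1) := by
  obtain ⟨p, rfl, rfl, hp⟩ := h'
  refine ⟨fun i => Nat.casesOn i u p, rfl, rfl, fun i hi => ?_⟩
  rcases i with _ | i
  · exact h
  · exact hp i (by omega)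

/-! ### Existence of an edge towards `v` -/

/-- No value between the positions i and j lies on the cyclic interval from u i to u j. If u i < u
j, then `between u i j` is empty; if the interval wraps around, its complement is the open interval
from u j to u i, so `between u i j` is all of `Ioo i j`. -/
lemma qbgEdge_mul_swap {n : ℕ} {u : Equiv.Perm (Fin n)} {i j q : Fin n} (hij : i < j)
    (hj : (u j - u i).val ≤ (q - u i).val)
    (hmin : ∀ l, i < l → l < j → (q - u i).val < (u l - u i).val) :
    QBGEdge u (u * Equiv.swap i j) := by
  refine ⟨i, j, hij, rfl, ?_⟩
  have hlt : ∀ l ∈ Finset.Ioo i j, (u j - u i).val < (u l - u i).val := fun l hl => by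
    rw [Finset.mem_Ioo] at hl
    exact hj.trans_lt (hmin l hl.1 hl.2)
  simp only [val_sub_eq] at hlt
  have hne : (u i).val ≠ (u j).val := fun h => hij.ne (u.injective (Fin.ext h))
  by_cases hu : u i < u j
  · left
    rw [length_mul_swap hij hu]
    have h0 : between u i j = ∅ := by
      refine Finset.filter_eq_empty_iff.2 fun l hl h => ?_
      have h1 := hlt l hl
      simp only [Fin.lt_def] at h hu
      split_ifs at h1 <;> omega
    simp [h0]
  · right
    have hu' : u j < u i := by
      rw [Fin.lt_def] at hu ⊢
      omega
    have hlen := length_mul_swap' hij hu'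
    have h0 : between u i j = Finset.Ioo i j := by
      refine Finset.filter_true_of_mem fun l hl => ?_
      have h1 := hlt l hl
      have := (u l).isLt
      have hli : (u l).val ≠ (u i).val := fun h =>
        (Finset.mem_Ioo.1 hl).1.ne' (u.injective (Fin.ext h))
      simp only [Fin.lt_def] at hu ⊢
      split_ifs at h1 <;> omega
    rw [h0, Fin.card_Ioo] at hlen
    rw [Fin.lt_def] at hij
    omega

/-- A window ending at `v i` contains more elements of `v[k+1]` than of `u[k+1]`, where `i` is
the first place in which `u` and `v` differ. -/
lemma shiftCount_lt_of_window {n : ℕ} {r : Fin n} {u v : Equiv.Perm (Fin n)} {i : Fin n} {k t : ℕ}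
    (h : GaleLE r (firstValues u (k + 1)) (firstValues v (k + 1))) (hik : i.val ≤ k)
    (hlow : ∀ l < i, u l = v l)
    (hwin : ∀ l, i ≤ l → l.val ≤ k → t ≤ (u l - r).val → (v i - r).val < (u l - r).val)
    (ht : t ≤ (v i - r).val) :
    shiftCount r (firstValues v (k + 1)) t < shiftCount r (firstValues u (k + 1)) t := by
  have hsplit : ∀ A : Finset (Fin n), shiftCount r A ((v i - r).val + 1) = shiftCount r A t +
      (A.filter fun x => t ≤ (x - r).val ∧ (x - r).val ≤ (v i - r).val).card := by
    intro A
    unfold shiftCount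
    rw [← Finset.card_union_of_disjoint]
    · congr 1
      ext x
      simp only [Finset.mem_union, Finset.mem_filter]
      by_cases hx : x ∈ A <;> simp only [hx, true_and, false_and, or_self]
      omega
    · rw [Finset.disjoint_left]
      intro x
      simp only [Finset.mem_filter]
      omega
  -- Up to the end of the window v has at most as many elements as u. Having strictly more inside
  -- the window, it has strictly fewer before it.
  have h1 := (galeLE_iff_shiftCount.1 h).2 ((v i - r).val + 1)
  rw [hsplit, hsplit] at h1
  have h2 : ((firstValues u (k + 1)).filter fun x => t ≤ (x - r).val ∧
      (x - r).val ≤ (v i - r).val).card < ((firstValues v (k + 1)).filter fun x =>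
        t ≤ (x - r).val ∧ (x - r).val ≤ (v i - r).val).card := by
    -- Elements of u in the window come from positions before i, where v agrees with u, whereas v
    -- has the further element v i.
    have hlt : ∀ x ∈ (firstValues u (k + 1)).filter fun x => t ≤ (x - r).val ∧
        (x - r).val ≤ (v i - r).val, ∃ l < i, u l = x := by
      intro x hx
      rw [Finset.mem_filter, mem_firstValues] at hx
      refine ⟨u.symm x, ?_, by simp⟩
      by_contra hl
      have := hwin (u.symm x) (not_lt.1 hl) (by omega)
      rw [Equiv.apply_symm_apply] at this
      have := this hx.2.1
      omega
    apply Finset.card_lt_card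
    rw [Finset.ssubset_iff_of_subset]
    · refine ⟨v i, ?_, fun hvi => ?_⟩
      · rw [Finset.mem_filter, mem_firstValues, Equiv.symm_apply_apply]
        exact ⟨by omega, ht, le_rfl⟩
      · obtain ⟨l, hl, hl'⟩ := hlt _ hvi
        rw [hlow l hl] at hl'
        exact hl.ne (v.injective hl')
    · intro x hx
      obtain ⟨l, hl, rfl⟩ := hlt x hx
      refine Finset.mem_filter.2 ⟨?_, (Finset.mem_filter.1 hx).2⟩
      rw [mem_firstValues, hlow l hl, Equiv.symm_apply_apply]
      rw [Fin.lt_def] at hl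
      omega
  omega

lemma shiftCount_insert {n : ℕ} (r : Fin n) {A : Finset (Fin n)} {p : Fin n} (hp : p ∉ A)
    (t : ℕ) : shiftCount r (insert p A) t =
      shiftCount r A t + if (p - r).val < t then 1 else 0 := by
  unfold shiftCount
  rw [Finset.filter_insert]
  split_ifs with h
  · rw [Finset.card_insert_of_notMem (by simp [hp])]
  · simp

/-- The cyclic interval from p to q, seen from r: the first alternative is the case without wrapping
past r, the second is the part after r when it wraps. -/
lemma val_sub_le_of_shift {n : ℕ} {r p q x : Fin n}
    (h : ((p - r).val < (x - r).val ∧ (x - r).val ≤ (q - r).val) ∨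
      ((x - r).val ≤ (q - r).val ∧ (q - r).val < (p - r).val)) :
    (x - p).val ≤ (q - p).val := by
  simp only [val_sub_eq] at *
  have := p.isLt
  have := q.isLt
  have := x.isLt
  have := r.isLt
  split_ifs at * <;> omega

lemma shift_of_val_sub_le {n : ℕ} {r p q x : Fin n} (hpq : (p - r).val < (q - r).val)
    (hx : x ≠ p) (h : (x - p).val ≤ (q - p).val) :
    (p - r).val < (x - r).val ∧ (x - r).val ≤ (q - r).val := by
  rw [ne_eq, Fin.ext_iff] at hx
  simp only [val_sub_eq] at *
  have := p.isLt
  have := q.isLt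
  have := x.isLt
  have := r.isLt
  split_ifs at * <;> omega

/-- Let i be the first position where u and v differ, and j the first later position whose value
lies on the cyclic interval from u i to v i. The edge swaps i and j: this moves the value at
position i towards v i, past none of the values at positions strictly between. -/
lemma exists_qbgEdge {n : ℕ} {a : Fin (n - 1) → Fin n} {u v : Equiv.Perm (Fin n)}
    (h : SeqLE a u v) (huv : u ≠ v) : ∃ u', QBGEdge u u' ∧ SeqLE a u u' ∧ SeqLE a u' v := by
  obtain ⟨i, hi, hlow⟩ : ∃ i, u i ≠ v i ∧ ∀ l < i, u l = v l := by
    have hne : ∃ i, u i ≠ v i := by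
      by_contra hne
      push Not at hne
      exact huv (Equiv.ext hne)
    obtain ⟨i, hi, hmin⟩ := WellFounded.has_min (wellFounded_lt (α := Fin n))
      {i | u i ≠ v i} hne
    exact ⟨i, hi, fun l hl => by_contra fun hne => hmin l hne hl⟩
  obtain ⟨j, hj, hmin⟩ := WellFounded.has_min (wellFounded_lt (α := Fin n))
    {j | i < j ∧ (u j - u i).val ≤ (v i - u i).val} ⟨u.symm (v i), by
      refine ⟨?_, by simp⟩
      by_contra hlt
      rcases (not_lt.1 hlt).lt_or_eq with hlt | heq
      · have h1 := hlow _ hlt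
        rw [Equiv.apply_symm_apply] at h1
        exact hlt.ne (v.injective h1.symm)
      · rw [Equiv.symm_apply_eq] at heq
        exact hi heq.symm⟩
  obtain ⟨hij, hj⟩ := hj
  have hout : ∀ l, i < l → l < j → (v i - u i).val < (u l - u i).val := fun l hl hlj => by
    by_contra hle
    exact hmin l ⟨hl, not_lt.1 hle⟩ hlj
  have hlevel : ∀ k : Fin (n - 1),
      GaleLE (a k) (firstValues u (k + 1)) (firstValues (u * Equiv.swap i j) (k + 1)) ∧
      GaleLE (a k) (firstValues (u * Equiv.swap i j) (k + 1)) (firstValues v (k + 1)) := by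
    intro k
    by_cases hk : i.val ≤ k.val ∧ k.val < j.val
    · obtain ⟨C, hCi, hCj, h1, h2⟩ := firstValues_mul_swap u hk.1 hk.2
      have hk' := h k
      generalize a k = r at hk' ⊢
      -- Otherwise the cyclic interval from u i to v i wraps past r, so no u l with i ≤ l ≤ k is at
      -- or before v i in ≤_r. The window starting at t = 0 would then give 0 < 0.
      have hpq : (u i - r).val < (v i - r).val := by
        by_contra hpq
        have hne : (u i - r).val ≠ (v i - r).val := fun he => hi (val_sub_injective r he)
        have := shiftCount_lt_of_window (t := 0) hk' hk.1 hlow (fun l hl hlk _ => by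
          rcases hl.lt_or_eq with hl | rfl
          · by_contra hle
            have h3 := hout l hl (by rw [Fin.lt_def]; omega)
            have h4 := val_sub_le_of_shift (r := r) (p := u i) (q := v i) (x := u l)
              (Or.inr ⟨not_lt.1 hle, by omega⟩)
            omega
          · omega) (Nat.zero_le _)
        simp [shiftCount] at this
      obtain ⟨hpm, hmq⟩ := shift_of_val_sub_le hpq (fun he => hij.ne' (u.injective he)) hj
      have hcard : (insert (u i) C).card = (insert (u j) C).card := by
        rw [Finset.card_insert_of_notMem hCi, Finset.card_insert_of_notMem hCj]
      have hcard' := hk'.card_eq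
      rw [h2, galeLE_iff_shiftCount, galeLE_iff_shiftCount]
      refine ⟨⟨by rw [h1, hcard], fun t => ?_⟩, ⟨by rw [← hcard, ← h1, hcard'], fun t => ?_⟩⟩
      · rw [h1, shiftCount_insert r hCi, shiftCount_insert r hCj]
        split_ifs <;> omega
      · have hle := (galeLE_iff_shiftCount.1 hk').2 t
        -- Replacing u i by u j lowers the count, by 1, only for these t. There the window from t to
        -- v i contains no u l with i ≤ l ≤ k, so the comparison with v has room for the loss.
        by_cases ht : (u i - r).val < t ∧ t ≤ (u j - r).val
        · have hlt := shiftCount_lt_of_window hk' hk.1 hlow (t := t) (fun l hl hlk htl => by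
            rcases hl.lt_or_eq with hl | rfl
            · by_contra hle
              have h3 := hout l hl (by rw [Fin.lt_def]; omega)
              have h4 := val_sub_le_of_shift (r := r) (p := u i) (q := v i) (x := u l)
                (Or.inl ⟨by omega, not_lt.1 hle⟩)
              omega
            · omega) (by omega)
          rw [h1, shiftCount_insert r hCi, if_pos ht.1] at hlt
          rw [shiftCount_insert r hCj]
          omega
        · rw [h1, shiftCount_insert r hCi] at hle
          rw [shiftCount_insert r hCj]
          split_ifs at hle ⊢ <;> omega
    · rw [firstValues_mul_swap_of_not u hij hk]
      exact ⟨GaleLE.refl _ _, h k⟩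
  exact ⟨u * Equiv.swap i j, qbgEdge_mul_swap hij hj hout, fun k => (hlevel k).1,
    fun k => (hlevel k).2⟩

lemma exists_hasPath {n : ℕ} {a : Fin (n - 1) → Fin n} {u v : Equiv.Perm (Fin n)}
    (h : SeqLE a u v) : ∃ k : ℕ, HasPath u v k ∧ (k : ℤ) = pathLength u v := by
  have hbound : ∀ u : Equiv.Perm (Fin n), 0 ≤ pathLength u v + (n * n : ℕ) := by
    intro u
    have h1 := length_le u
    have h2 : 0 ≤ ∑ k : Fin (n - 1), supHeight (firstValues u (k + 1)) (firstValues v (k + 1)) :=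
      Finset.sum_nonneg fun k _ => supHeight_nonneg _ _
    unfold pathLength
    omega
  -- That `pathLength` is nonnegative is not yet known, so it is shifted by the crude bound n * n on
  -- lengths to give a measure that drops by 1 along each edge.
  induction hm : (pathLength u v + (n * n : ℕ)).toNat generalizing u with
  | zero =>
    by_cases huv : u = v
    · subst huv
      exact ⟨0, ⟨fun _ => u, rfl, rfl, fun i hi => absurd hi (Nat.not_lt_zero i)⟩,
        by simp [pathLength_self]⟩
    · obtain ⟨u', he, h1, h2⟩ := exists_qbgEdge h huv
      have := pathLength_add h1 h2
      have := he.pathLength_eq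
      have := hbound u'
      omega
  | succ m ih =>
    by_cases huv : u = v
    · subst huv
      exact ⟨0, ⟨fun _ => u, rfl, rfl, fun i hi => absurd hi (Nat.not_lt_zero i)⟩,
        by simp [pathLength_self]⟩
    · obtain ⟨u', he, h1, h2⟩ := exists_qbgEdge h huv
      have h3 := pathLength_add h1 h2
      have h4 := he.pathLength_eq
      have := hbound u'
      obtain ⟨k, hk, hk'⟩ := ih h2 (by omega)
      exact ⟨k + 1, HasPath.cons he hk, by push_cast; omega⟩

lemma dist_eq_pathLength {n : ℕ} (u v : Equiv.Perm (Fin n)) :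
    (dist u v : ℤ) = pathLength u v := by
  obtain ⟨a, ha⟩ := exists_seqLE u v
  obtain ⟨k, hk, hk'⟩ := exists_hasPath ha
  -- A path exists, so the infimum is attained and is not the default value 0 for an empty set.
  have h1 : HasPath u v (dist u v) := Nat.sInf_mem (s := {k | HasPath u v k}) ⟨k, hk⟩
  have h2 : dist u v ≤ k := Nat.sInf_le hk
  have := h1.pathLength_le
  omega

/-! ### Tilted intervals -/

/-- The tilted interval `[u, v]` in terms of the order `≤_𝐚`. -/
lemma tiltedLE_self_iff {n : ℕ} {a : Fin (n - 1) → Fin n} {u w v : Equiv.Perm (Fin n)}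
    (h : SeqLE a u v) : TiltedLE u w v ↔ SeqLE a u w ∧ SeqLE a w v := by
  have key : TiltedLE u w v ↔ pathLength u w + pathLength w v = pathLength u v := by
    rw [← dist_eq_pathLength, ← dist_eq_pathLength, ← dist_eq_pathLength]
    unfold TiltedLE
    omega
  rw [key]
  exact ⟨seqLE_of_pathLength_add h, fun h' => pathLength_add h'.1 h'.2⟩

lemma dist_self {n : ℕ} (u : Equiv.Perm (Fin n)) : dist u u = 0 := by
  have := dist_eq_pathLength u u
  rw [pathLength_self] at this
  omega

lemma tiltedLE_refl {n : ℕ} (u w : Equiv.Perm (Fin n)) : TiltedLE u w w := by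
  simp [TiltedLE, dist_self]

lemma tiltedLE_bot {n : ℕ} (u w : Equiv.Perm (Fin n)) : TiltedLE u u w := by
  simp [TiltedLE, dist_self]

/-- The endpoint y lies in its own interval, so containment in [u, v] gives y ≤_a v. The same `a`
then satisfies u ≤_a y and describes the interval below y too. -/
lemma mem_subintervals {n : ℕ} {a : Fin (n - 1) → Fin n} {u v x y : Equiv.Perm (Fin n)}
    (h : SeqLE a u v) :
    (x, y) ∈ subintervals u v ↔ SeqLE a u x ∧ SeqLE a x y ∧ SeqLE a y v := by
  constructor
  · rintro ⟨hxy, hsub⟩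
    obtain ⟨h1, h2⟩ := (tiltedLE_self_iff h).1 (hsub ⟨hxy, tiltedLE_refl u y⟩).2
    obtain ⟨h3, h4⟩ := (tiltedLE_self_iff h1).1 hxy
    exact ⟨h3, h4, h2⟩
  · rintro ⟨h1, h2, h3⟩
    refine ⟨(tiltedLE_self_iff (h1.trans h2)).2 ⟨h1, h2⟩, fun z hz => ⟨tiltedLE_bot u z, ?_⟩⟩
    obtain ⟨h4, h5⟩ := (tiltedLE_self_iff (h1.trans h2)).1 hz.2
    exact (tiltedLE_self_iff h).2 ⟨h4, h5.trans h3⟩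

end TiltedRichardson

/-- The first two parts say that the tilted Richardson varieties of the pair `(u, v)` are well
defined; the last two say that `T_{u,v}` is the disjoint union of the strata `T°_{x,y}`. -/
theorem theorem5p2 (n : ℕ) (u v : Equiv.Perm (Fin n)) :
    (∃ a : Fin (n - 1) → Fin n, TiltedRichardson.SeqLE a u v) ∧
    (∀ a : Fin (n - 1) → Fin n, TiltedRichardson.SeqLE a u v →
      TiltedRichardson.tiltedRichardsonWrt a u v = TiltedRichardson.tiltedRichardson u v ∧
      TiltedRichardson.openTiltedRichardsonWrt a u v =
        TiltedRichardson.openTiltedRichardson u v) ∧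
    TiltedRichardson.tiltedRichardson u v =
      ⋃ p ∈ TiltedRichardson.subintervals u v,
        TiltedRichardson.openTiltedRichardson p.1 p.2 ∧
    (TiltedRichardson.subintervals u v).PairwiseDisjoint
      (fun p => TiltedRichardson.openTiltedRichardson p.1 p.2) := by
  open TiltedRichardson in
  obtain ⟨a, ha⟩ := exists_seqLE u v
  refine ⟨⟨a, ha⟩, fun b hb => ⟨tiltedRichardsonWrt_eq hb, openTiltedRichardsonWrt_eq hb⟩, ?_, ?_⟩
  · ext F
    simp only [Set.mem_iUnion]
    constructor
    · intro hF
      rw [← tiltedRichardsonWrt_eq ha] at hF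
      obtain ⟨x, y, h1, h2, h3, hxy⟩ := exists_mem_openTiltedRichardsonWrt ha hF
      exact ⟨(x, y), (mem_subintervals ha).2 ⟨h1, h2, h3⟩, a, h2, hxy⟩
    · rintro ⟨⟨x, y⟩, hp, hF⟩
      obtain ⟨h1, h2, h3⟩ := (mem_subintervals ha).1 hp
      simp only at hF
      rw [← openTiltedRichardsonWrt_eq h2, mem_openTiltedRichardsonWrt] at hF
      rw [← tiltedRichardsonWrt_eq ha, mem_tiltedRichardsonWrt]
      intro k
      rw [← (hF k).1, ← (hF k).2]
      exact ⟨h1 k, h3 k⟩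
  · rintro ⟨x, y⟩ hp ⟨x', y'⟩ hp' hne
    refine Set.disjoint_left.2 fun F hF hF' => hne ?_
    simp only at hF hF'
    -- The one sequence `a` is admissible for both pairs, so each pair is read off from the same
    -- least and greatest bases of the spaces of the flag.
    rw [← openTiltedRichardsonWrt_eq ((mem_subintervals ha).1 hp).2.1,
      mem_openTiltedRichardsonWrt] at hF
    rw [← openTiltedRichardsonWrt_eq ((mem_subintervals ha).1 hp').2.1,
      mem_openTiltedRichardsonWrt] at hF'
    rw [Prod.mk.injEq]
    exact ⟨eq_of_firstValues_eq fun k => (hF k).1.trans (hF' k).1.symm,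
      eq_of_firstValues_eq fun k => (hF k).2.trans (hF' k).2.symm⟩
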